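/- Let $\mathbb T=\mathbb R/L\mathbb Z$ with $L>0$, and for $r\ge 0$ let $H^r(\mathbb T)$ be the space of $f\in L^2(\mathbb T;\mathbb C)$ with $\|f\|_{H^r}^2=\sum_{k\in\mathbb Z}(1+|2\pi k/L|^2)^r|\hat f(k)|^2<\infty$, where $\hat f(k)$ are the Fourier coefficients. Let $s\ge 3$ be real, let $\psi_{\mathrm{in}}\in H^s(\mathbb T)$, let $v_0,v_1,v_2,\dots\in H^s(\mathbb T)$ with all $v_j$ ($j\ge0$) real-valued, let $\lambda_1\ge\lambda_2\ge\dots>0$ with $\sum_{j\ge1}\lambda_j\|v_j\|_{H^s}<\infty$, and let $G$ be a bounded linear functional on $H^1(\mathbb T)$. Let $U=\mathbb R^{\mathbb N}$ carry the product Gaussian measure $\mu=\bigotimes_{j\ge1}\mathcal N(0,1)$, with expectation $\mathbb E$. For $m\in\mathbb N$ and $\xi\in U$ put $V_m(\xi,x)=v_0(x)+\sum_{j=1}^m\lambda_j\xi_jv_j(x)$. For every $m$ and every $\xi\in U$ the Schrödinger equation $\mathrm i\partial_t\psi_m=-\tfrac12\partial_x^2\psi_m+V_m(\xi,\cdot)\psi_m$,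 $\psi_m(0)=\psi_{\mathrm{in}}$, has exactly one solution $\psi_m(\cdot,\xi)\in C([0,\infty);L^2(\mathbb T))$ in the sense of Duhamel's formula $$\psi_m(t)=\mathrm e^{\mathrm it\partial_x^2/2}\psi_{\mathrm{in}}-\mathrm i\int_0^t\mathrm e^{\mathrm i(t-\rho)\partial_x^2/2}V_m\,\psi_m(\rho)\,\mathrm d\rho,\qquad t\ge0 .$$ For $\tau>0$ let $\psi_m^n$ be the Lie–Trotter splitting solution, $\psi_m^0=\psi_{\mathrm{in}}$ and $\psi_m^{n+1}=\mathrm e^{\mathrm i\tau\partial_x^2/2}\mathrm e^{-\mathrm i\tau V_m}\psi_m^n$, and let $t_n=n\tau$. Then for every $T>0$ there is a constant $C>0$, independent of $m$, $\tau$ and $n$, such that for all $m$, all $0<\tau\le T$ and all $n\ge0$ with $t_n\le T$: the map $\xi\mapsto\psi_m(t_n,\xi)-\psi_m^n(\xi)$ belongs to $L^2_\mu(U,H^{s-2}(\mathbb T))$ and $$\|\psi_m(t_n)-\psi_m^n\|_{L^2_\mu(U,H^{s-2}(\mathbb T))}\le C\tau ;$$ moreover $|\psi_m(t_n)|^2$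 and $|\psi_m^n|^2$ take values in $H^1(\mathbb T)$, $G(|\psi_m(t_n)|^2)$ and $G(|\psi_m^n|^2)$ are $\mu$-integrable, and $$\bigl|\mathbb E[G(|\psi_m(t_n)|^2)]-\mathbb E[G(|\psi_m^n|^2)]\bigr|\le C\tau .$$ -/

import Mathlib

open MeasureTheory ProbabilityTheory Set

noncomputable section

/-- `L²(𝕋; ℂ)` on the one-dimensional torus `𝕋 = ℝ / (L ℤ)` of length `L`. The measure is Lebesgue
measure normalised to total mass one. -/
abbrev TorusL2 (L : ℝ) [Fact (0 < L)] : Type :=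
  Lp ℂ 2 (AddCircle.haarAddCircle : Measure (AddCircle L))

/-- The frequency `2 π k / L` of the `k`-th Fourier mode, so that
`∂ₓ fourier k = i (2 π k / L) fourier k`. -/
def torusFreq (L : ℝ) (k : ℤ) : ℝ := 2 * Real.pi * k / L

/-- The weight `(1 + |2 π k / L|²) ^ r` in the squared `H^r` norm. -/
def sobolevWeight (L r : ℝ) (k : ℤ) : ℝ := (1 + torusFreq L k ^ 2) ^ r

/-- `f ∈ H^r(𝕋)` (for real order `r ≥ 0`): `f` is square integrable and
`∑ₖ (1 + |2 π k / L|²) ^ r |f̂(k)|² < ∞`. -/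
def MemSobolev {L : ℝ} [Fact (0 < L)] (r : ℝ) (f : AddCircle L → ℂ) : Prop :=
  MemLp f 2 (AddCircle.haarAddCircle : Measure (AddCircle L)) ∧
    Summable fun k : ℤ => sobolevWeight L r k * ‖fourierCoeff f k‖ ^ 2

theorem sobolevWeight_pos (L r : ℝ) (k : ℤ) : 0 < sobolevWeight L r k := by
  unfold sobolevWeight
  positivity

theorem sobolevWeight_half_sq (L r : ℝ) (k : ℤ) :
    sobolevWeight L (r / 2) k ^ 2 = sobolevWeight L r k := by
  unfold sobolevWeight
  rw [← Real.rpow_natCast, ← Real.rpow_mul (by positivity)]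
  congr 1
  push_cast
  ring

theorem memSobolev_coe_iff {L : ℝ} [Fact (0 < L)] (r : ℝ) (f : TorusL2 L) :
    MemSobolev r (f : AddCircle L → ℂ) ↔
      Memℓp (fun k : ℤ => (sobolevWeight L (r / 2) k : ℂ) * fourierBasis.repr f k) 2 := by
  have h : (fun k : ℤ => sobolevWeight L r k * ‖fourierCoeff (f : AddCircle L → ℂ) k‖ ^ 2) =
      fun k : ℤ => ‖(sobolevWeight L (r / 2) k : ℂ) * fourierBasis.repr f k‖ ^ (2 : ℝ) := by
    funext k
    rw [fourierBasis_repr, norm_mul, Complex.norm_real, Real.norm_eq_abs,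
      abs_of_pos (sobolevWeight_pos _ _ _), ← sobolevWeight_half_sq L r k]
    norm_cast
    rw [mul_pow]
  unfold MemSobolev
  rw [memℓp_gen_iff (by norm_num), h]
  simp [Lp.memLp f]

/-- `H^r(𝕋)` as a linear subspace of `L²(𝕋)`. -/
def sobolevSubmodule (L : ℝ) [Fact (0 < L)] (r : ℝ) : Submodule ℂ (TorusL2 L) where
  carrier := {f | MemSobolev r (f : AddCircle L → ℂ)}
  zero_mem' := by
    simp only [mem_ofPred_eq, memSobolev_coe_iff]
    convert (zero_memℓp : Memℓp (0 : ℤ → ℂ) 2) using 1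
    funext k
    simp
  add_mem' := by
    intro f g hf hg
    simp only [mem_ofPred_eq, memSobolev_coe_iff] at *
    convert hf.add hg using 1
    funext k
    simp [mul_add]
  smul_mem' := by
    intro c f hf
    simp only [mem_ofPred_eq, memSobolev_coe_iff] at *
    convert hf.const_smul c using 1
    funext k
    simp [mul_left_comm]

/-- The Sobolev space `H^r(𝕋)`. It is a type of its own, because its norm is not the one that the
subspace inherits from `L²(𝕋)`. -/
def SobolevSpace (L : ℝ) [Fact (0 < L)] (r : ℝ) : Type := ↥(sobolevSubmodule L r)

instance (L : ℝ) [Fact (0 < L)] (r : ℝ) : AddCommGroup (SobolevSpace L r) :=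
  inferInstanceAs (AddCommGroup ↥(sobolevSubmodule L r))

instance (L : ℝ) [Fact (0 < L)] (r : ℝ) : Module ℂ (SobolevSpace L r) :=
  inferInstanceAs (Module ℂ ↥(sobolevSubmodule L r))

/-- The inclusion `H^r(𝕋) ⊆ L²(𝕋)`. -/
def SobolevSpace.toL2 {L : ℝ} [Fact (0 < L)] {r : ℝ} : SobolevSpace L r →ₗ[ℂ] TorusL2 L :=
  (sobolevSubmodule L r).subtype

/-- A function in `L²(𝕋)` that satisfies `MemSobolev r`, as an element of `H^r(𝕋)`. -/
def SobolevSpace.mk {L : ℝ} [Fact (0 < L)] {r : ℝ} (f : TorusL2 L)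
    (hf : MemSobolev r (f : AddCircle L → ℂ)) : SobolevSpace L r := Subtype.mk f hf

theorem SobolevSpace.memSobolev {L : ℝ} [Fact (0 < L)] {r : ℝ} (f : SobolevSpace L r) :
    MemSobolev r (f.toL2 : AddCircle L → ℂ) := f.2

/-- The weighted Fourier coefficients `((1 + |2 π k / L|²) ^ (r / 2) f̂(k))ₖ ∈ ℓ²(ℤ)`. -/
def SobolevSpace.weightedCoeff {L : ℝ} [Fact (0 < L)] {r : ℝ} :
    SobolevSpace L r →ₗ[ℂ] lp (fun _ : ℤ => ℂ) 2 where
  toFun f := ⟨fun k => (sobolevWeight L (r / 2) k : ℂ) * fourierBasis.repr f.toL2 k,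
    (memSobolev_coe_iff r _).1 f.memSobolev⟩
  map_add' f g := by
    ext k
    simp only [map_add, lp.coeFn_add, Pi.add_apply, mul_add]
  map_smul' c f := by
    ext k
    simp [mul_left_comm]

theorem SobolevSpace.weightedCoeff_injective {L : ℝ} [Fact (0 < L)] {r : ℝ} :
    Function.Injective (SobolevSpace.weightedCoeff (L := L) (r := r)) := by
  intro f g h
  apply Subtype.ext
  apply fourierBasis.repr.injective
  ext k
  have hk : (sobolevWeight L (r / 2) k : ℂ) * fourierBasis.repr f.toL2 k =
      (sobolevWeight L (r / 2) k : ℂ) * fourierBasis.repr g.toL2 k :=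
    congrArg (fun a : lp (fun _ : ℤ => ℂ) 2 => a k) h
  exact mul_left_cancel₀ (Complex.ofReal_ne_zero.2 (sobolevWeight_pos _ _ _).ne') hk

/-- The `H^r(𝕋)` norm, `‖f‖² = ∑ₖ (1 + |2 π k / L|²) ^ r |f̂(k)|²`. -/
instance (L : ℝ) [Fact (0 < L)] (r : ℝ) : NormedAddCommGroup (SobolevSpace L r) :=
  NormedAddCommGroup.induced _ _ SobolevSpace.weightedCoeff SobolevSpace.weightedCoeff_injective

instance (L : ℝ) [Fact (0 < L)] (r : ℝ) : NormedSpace ℂ (SobolevSpace L r) :=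
  NormedSpace.induced ℂ _ _ SobolevSpace.weightedCoeff

theorem SobolevSpace.norm_sq_eq {L : ℝ} [Fact (0 < L)] {r : ℝ} (f : SobolevSpace L r) :
    ‖f‖ ^ 2 = ∑' k : ℤ, sobolevWeight L r k *
      ‖fourierCoeff (f.toL2 : AddCircle L → ℂ) k‖ ^ 2 := by
  have h : ‖f‖ = ‖SobolevSpace.weightedCoeff f‖ := rfl
  have h2 := lp.norm_rpow_eq_tsum (p := 2) (by norm_num) (SobolevSpace.weightedCoeff f)
  rw [h]
  norm_num at h2
  rw [h2]
  refine tsum_congr fun k => ?_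
  change ‖(sobolevWeight L (r / 2) k : ℂ) * fourierBasis.repr f.toL2 k‖ ^ 2 = _
  rw [fourierBasis_repr, norm_mul, mul_pow, Complex.norm_real, Real.norm_eq_abs, sq_abs,
    sobolevWeight_half_sq]

open Classical in
/-- The element of `H^r(𝕋)` given by a function `f` with `MemSobolev r f`
(and `0` if `f` is not in `H^r(𝕋)`). -/
def toSobolev {L : ℝ} [Fact (0 < L)] (r : ℝ) (f : AddCircle L → ℂ) : SobolevSpace L r :=
  if h : MemSobolev r f then
    SobolevSpace.mk (h.1.toLp f)
      ⟨Lp.memLp _, by simpa only [fourierCoeff_congr_ae h.1.coeFn_toLp] using h.2⟩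
  else 0

open Classical in
/-- The pointwise product of a function `g` with `f ∈ L²(𝕋)`, as an element of `L²(𝕋)`
(and `0` if the product is not square integrable, which cannot happen for bounded `g`). -/
def mulL2 {L : ℝ} [Fact (0 < L)] (g : AddCircle L → ℂ) (f : TorusL2 L) : TorusL2 L :=
  if h : MemLp (fun x => g x * f x) 2 (AddCircle.haarAddCircle : Measure (AddCircle L)) then
    h.toLp _
  else 0

theorem freeFlow_memℓp {L : ℝ} [Fact (0 < L)] (t : ℝ) (f : TorusL2 L) :
    Memℓp (fun k : ℤ => Complex.exp (-(Complex.I * t * (torusFreq L k : ℂ) ^ 2 / 2)) *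
      fourierBasis.repr f k) 2 := by
  have h := lp.memℓp (fourierBasis.repr f)
  rw [memℓp_gen_iff (by norm_num)] at h ⊢
  refine h.congr fun k => ?_
  have e : -(Complex.I * t * (torusFreq L k : ℂ) ^ 2 / 2) =
      ((-(t * torusFreq L k ^ 2 / 2) : ℝ) : ℂ) * Complex.I := by
    push_cast
    ring
  rw [norm_mul, e, Complex.norm_exp_ofReal_mul_I, one_mul]

/-- The free Schrödinger group `exp(i t ∂ₓ² / 2)` on `L²(𝕋)`: it multiplies the `k`-th Fourier
coefficient by `exp(-i t (2 π k / L)² / 2)`. -/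
def freeFlow {L : ℝ} [Fact (0 < L)] (t : ℝ) (f : TorusL2 L) : TorusL2 L :=
  fourierBasis.repr.symm
    ⟨fun k : ℤ => Complex.exp (-(Complex.I * t * (torusFreq L k : ℂ) ^ 2 / 2)) *
      fourierBasis.repr f k, freeFlow_memℓp t f⟩

/-- `u` is the solution on `[0, ∞)` of `i ∂ₜ u = -½ ∂ₓ² u + V u`, `u(0) = u₀`, in the sense of
Duhamel's formula
`u(t) = exp(i t ∂ₓ²/2) u₀ - i ∫₀ᵗ exp(i (t - ρ) ∂ₓ²/2) (V u(ρ)) dρ`. -/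
def IsMildSolution {L : ℝ} [Fact (0 < L)] (V : AddCircle L → ℂ) (u₀ : TorusL2 L)
    (u : ℝ → TorusL2 L) : Prop :=
  ContinuousOn u (Ici 0) ∧
    ∀ t : ℝ, 0 ≤ t →
      u t = freeFlow t u₀ -
        Complex.I • ∫ ρ in (0 : ℝ)..t, freeFlow (t - ρ) (mulL2 V (u ρ))

/-- The Lie-Trotter splitting `u^{n+1} = exp(i τ ∂ₓ²/2) exp(-i τ V) u^n`, `u^0 = u₀`. -/
def lieTrotter {L : ℝ} [Fact (0 < L)] (V : AddCircle L → ℂ) (u₀ : TorusL2 L) (τ : ℝ) :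
    ℕ → TorusL2 L
  | 0 => u₀
  | n + 1 => freeFlow τ
      (mulL2 (fun x => Complex.exp (-(Complex.I * τ * V x))) (lieTrotter V u₀ τ n))

/-- The truncated potential `V_m(ξ) = v₀ + ∑_{j = 1}^m λ_j ξ_j v_j`. The families `lam`, `v` and
the parameters `ξ` are indexed from zero, so that `lam j` stands for `λ_{j+1}` and so on. -/
def truncPotential {L : ℝ} [Fact (0 < L)] {s : ℝ} (v₀ : SobolevSpace L s)
    (v : ℕ → SobolevSpace L s) (lam : ℕ → ℝ) (m : ℕ) (ξ : ℕ → ℝ) : SobolevSpace L s :=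
  v₀ + ∑ j ∈ Finset.range m, ((lam j * ξ j : ℝ) : ℂ) • v j

/-- The product Gaussian measure `⨂_{j ≥ 1} N(0, 1)` on `U = ℝ^ℕ`. -/
def gaussianProduct : Measure (ℕ → ℝ) := Measure.infinitePi fun _ : ℕ => gaussianReal 0 1

/-- The position density `|f|²`. -/
def positionDensity {L : ℝ} [Fact (0 < L)] (f : TorusL2 L) : AddCircle L → ℂ :=
  fun x => ((‖f x‖ ^ 2 : ℝ) : ℂ)

end

/-!
All pathwise bounds are exponential in `‖V‖_{H^s}`, and this norm has exponential moments of every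
order that are uniform in the truncation index.

*Pathwise analysis.* For `r ≥ 1` the space `H^r` is an algebra (`exists_product_bound`), so that
multiplication by `-i V` is a bounded operator on `H^s`, on `H^{s-2}` and on `L²`, and the
inclusions intertwine the three operators. The solution of Duhamel's formula for a bounded
perturbation of an isometry group is the sum of its Dyson series and is unique
(`exists_isDuhamel`, `IsDuhamel.unique`); uniqueness in `L²` therefore shows that the mild
solution is the one constructed in `H^s`, with `‖ψ(t)‖_{H^s} ≤ exp(b t) ‖ψ_in‖_{H^s}` and `b`
proportional to `‖V‖_{H^s}`. The splitting solution obeys the same bound. The free flow is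
Lipschitz in time from `H^s` to `H^{s-2}` (`norm_flow_sub_le`). This makes the local error of the
splitting quadratic in `τ` in `H^{s-2}` (`norm_local_error_le`), and stability in `H^{s-2}` gives
a global error `≤ 4 T exp((2 + T) b) ‖ψ_in‖_{H^s} τ` (`norm_lieSplit_error_le`,
`pathwise_bounds`).

*Averaging.* By convexity, `exp (∑ a_j |ξ_j|)` is dominated by a convex combination of the
functions `exp (A |ξ_j|)` with `A` of the size of `∑ a_j`, which bounds its expectation by a
Gaussian integral in one variable, for all truncations at once (`exists_exp_moment_bound`). The
splitting solution depends continuously on the potential, and the exact solution is a pointwise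
limit of splitting solutions with smaller and smaller steps, so both are measurable in `ξ`. The
density `|ψ|² = ψ * conj ψ` is a continuous quadratic function on `H¹`, so the error of the
observable follows from the error of the wave function and `s - 2 ≥ 1`.
-/

/-! ### Duhamel's formula for an isometry group and a bounded perturbation -/

section Duhamel

variable {E : Type*} [NormedAddCommGroup E] [NormedSpace ℝ E]

/-- A strongly continuous one-parameter group of linear isometries. -/
structure IsIsometryGroup (S : ℝ → E →L[ℝ] E) : Prop where
  zero : ∀ x, S 0 x = x
  add : ∀ s t x, S (s + t) x = S s (S t x)
  norm : ∀ t x, ‖S t x‖ = ‖x‖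
  cont : ∀ x, Continuous fun t => S t x

theorem IsIsometryGroup.continuous_uncurry {S : ℝ → E →L[ℝ] E} (hS : IsIsometryGroup S) :
    Continuous fun p : ℝ × E => S p.1 p.2 := by
  refine continuous_prod_of_continuous_lipschitzWith' _ 1 (fun t => ?_) hS.cont
  refine LipschitzWith.of_dist_le_mul fun x y => ?_
  simp only [dist_eq_norm, ← map_sub, hS.norm, NNReal.coe_one, one_mul, le_refl]

/-- The equation `u(t) = S(t) x + ∫₀ᵗ S(t - ρ) B u(ρ) dρ` for `t ≥ 0`, with `u` continuous. -/
def IsDuhamel (S : ℝ → E →L[ℝ] E) (B : E →L[ℝ] E) (x : E) (u : ℝ → E) : Prop :=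
  ContinuousOn u (Ici 0) ∧
    ∀ t : ℝ, 0 ≤ t → u t = S t x + ∫ ρ in (0 : ℝ)..t, S (t - ρ) (B (u ρ))

/-- The `k`-th term of the Dyson series of the solution of `IsDuhamel`. -/
noncomputable def dysonTerm (S : ℝ → E →L[ℝ] E) (B : E →L[ℝ] E) (x : E) : ℕ → ℝ → E
  | 0 => fun t => S t x
  | k + 1 => fun t => ∫ ρ in (0 : ℝ)..t, S (t - ρ) (B (dysonTerm S B x k ρ))

theorem continuous_dysonTerm {S : ℝ → E →L[ℝ] E} (hS : IsIsometryGroup S) (B : E →L[ℝ] E)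
    (x : E) (k : ℕ) : Continuous (dysonTerm S B x k) := by
  induction k with
  | zero => exact hS.cont x
  | succ k ih =>
    refine intervalIntegral.continuous_parametric_intervalIntegral_of_continuous
      (f := fun t ρ => S (t - ρ) (B (dysonTerm S B x k ρ))) ?_ continuous_id
    exact hS.continuous_uncurry.comp
      ((continuous_fst.sub continuous_snd).prodMk (B.continuous.comp (ih.comp continuous_snd)))

theorem norm_duhamel_integrand_le {S : ℝ → E →L[ℝ] E} (hS : IsIsometryGroup S) {B : E →L[ℝ] E}
    {b : ℝ} (hb : ‖B‖ ≤ b) (t : ℝ) (y : E) : ‖S t (B y)‖ ≤ b * ‖y‖ := by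
  rw [hS.norm]
  exact (B.le_opNorm y).trans (by gcongr)

/-- One application of the Duhamel integral turns a bound `M (b ρ)ᵏ / k!` into the next one. -/
theorem norm_duhamel_integral_le {S : ℝ → E →L[ℝ] E} (hS : IsIsometryGroup S) {B : E →L[ℝ] E}
    {b : ℝ} (hb : ‖B‖ ≤ b) {M t : ℝ} (ht : 0 ≤ t) {k : ℕ} {f : ℝ → E}
    (hf : ∀ ρ ∈ Icc 0 t, ‖f ρ‖ ≤ M * ((b * ρ) ^ k / k.factorial)) :
    ‖∫ ρ in (0 : ℝ)..t, S (t - ρ) (B (f ρ))‖ ≤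
      M * ((b * t) ^ (k + 1) / (k + 1).factorial) := by
  have hb0 : 0 ≤ b := (norm_nonneg _).trans hb
  have h1 : ∀ ρ ∈ Ioc 0 t,
      ‖S (t - ρ) (B (f ρ))‖ ≤ b * (M * ((b * ρ) ^ k / k.factorial)) := fun ρ hρ =>
    (norm_duhamel_integrand_le hS hb _ _).trans (by gcongr; exact hf ρ ⟨hρ.1.le, hρ.2⟩)
  refine (intervalIntegral.norm_integral_le_of_norm_le ht (Filter.Eventually.of_forall h1)
    (Continuous.intervalIntegrable (by fun_prop) _ _)).trans (le_of_eq ?_)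
  have h2 : ∀ ρ : ℝ, b * (M * ((b * ρ) ^ k / k.factorial)) =
      (M * b ^ (k + 1) / k.factorial) * ρ ^ k := fun ρ => by
    rw [mul_pow]; ring
  simp only [h2]
  rw [intervalIntegral.integral_const_mul, integral_pow, Nat.factorial_succ, mul_pow]
  have : (k.factorial : ℝ) ≠ 0 := by positivity
  push_cast
  field_simp
  simp

theorem norm_dysonTerm_le {S : ℝ → E →L[ℝ] E} (hS : IsIsometryGroup S) {B : E →L[ℝ] E}
    {b : ℝ} (hb : ‖B‖ ≤ b) (x : E) (k : ℕ) {t : ℝ} (ht : 0 ≤ t) :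
    ‖dysonTerm S B x k t‖ ≤ ‖x‖ * ((b * t) ^ k / k.factorial) := by
  induction k generalizing t with
  | zero => simp [dysonTerm, hS.norm]
  | succ k ih => exact norm_duhamel_integral_le hS hb ht fun ρ hρ => ih hρ.1

theorem hasSum_pow_div_factorial (c : ℝ) :
    HasSum (fun k : ℕ => c ^ k / k.factorial) (Real.exp c) := by
  rw [Real.exp_eq_exp_ℝ]
  exact NormedSpace.expSeries_div_hasSum_exp c

/-- The Duhamel equation has a solution, the sum of its Dyson series. -/
theorem exists_isDuhamel [CompleteSpace E] {S : ℝ → E →L[ℝ] E} (hS : IsIsometryGroup S)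
    {B : E →L[ℝ] E} {b : ℝ} (hb : ‖B‖ ≤ b) (x : E) :
    ∃ u, IsDuhamel S B x u ∧ ∀ t, 0 ≤ t → ‖u t‖ ≤ Real.exp (b * t) * ‖x‖ := by
  have hb0 : 0 ≤ b := (norm_nonneg _).trans hb
  have hsum : ∀ c, HasSum (fun k : ℕ => ‖x‖ * (c ^ k / k.factorial)) (‖x‖ * Real.exp c) :=
    fun c => (hasSum_pow_div_factorial c).mul_left _
  have hterm : ∀ {t}, 0 ≤ t → HasSum (fun k => dysonTerm S B x k t) (∑' k, dysonTerm S B x k t) :=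
    fun {t} ht => (Summable.of_norm_bounded (hsum (b * t)).summable
      fun k => norm_dysonTerm_le hS hb x k ht).hasSum
  refine ⟨fun t => ∑' k, dysonTerm S B x k t, ⟨?_, ?_⟩, ?_⟩
  · intro t ht
    have h : ContinuousOn (fun t => ∑' k, dysonTerm S B x k t) (Icc 0 (t + 1)) := by
      refine continuousOn_tsum (fun k => (continuous_dysonTerm hS B x k).continuousOn)
        (hsum (b * (t + 1))).summable fun k ρ hρ => ?_
      refine (norm_dysonTerm_le hS hb x k hρ.1).trans ?_
      have := hρ.1
      have := hρ.2
      gcongr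
    refine (h t ⟨ht, by linarith⟩).mono_of_mem_nhdsWithin ?_
    filter_upwards [self_mem_nhdsWithin, mem_nhdsWithin_of_mem_nhds (Iio_mem_nhds (lt_add_one t))]
      with ρ h1 h2 using ⟨h1, le_of_lt h2⟩
  · intro t ht
    have hint : HasSum (fun k => ∫ ρ in (0 : ℝ)..t, S (t - ρ) (B (dysonTerm S B x k ρ)))
        (∫ ρ in (0 : ℝ)..t, S (t - ρ) (B (∑' k, dysonTerm S B x k ρ))) := by
      refine intervalIntegral.hasSum_integral_of_dominated_convergence
        (fun k _ => b * (‖x‖ * ((b * t) ^ k / k.factorial))) (fun k => ?_) (fun k => ?_) ?_ ?_ ?_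
      · refine Continuous.aestronglyMeasurable ?_
        exact hS.continuous_uncurry.comp ((continuous_const.sub continuous_id).prodMk
          (B.continuous.comp (continuous_dysonTerm hS B x k)))
      · refine Filter.Eventually.of_forall fun ρ hρ => ?_
        rw [uIoc_of_le ht] at hρ
        refine (norm_duhamel_integrand_le hS hb _ _).trans ?_
        have := hρ.1.le
        have := hρ.2
        gcongr
        refine (norm_dysonTerm_le hS hb x k hρ.1.le).trans ?_
        gcongr
      · exact Filter.Eventually.of_forall fun _ _ => ((hsum (b * t)).mul_left b).summable
      · exact intervalIntegrable_const
      · refine Filter.Eventually.of_forall fun ρ hρ => ?_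
        rw [uIoc_of_le ht] at hρ
        exact ((S (t - ρ)).comp B).hasSum (hterm hρ.1.le)
    have h := (hasSum_nat_add_iff' (f := fun k => dysonTerm S B x k t) 1).2 (hterm ht)
    have h2 := h.unique hint
    simp only [Finset.sum_range_one] at h2
    rw [← h2]
    simp [dysonTerm]
  · intro t ht
    refine (tsum_of_norm_bounded (hsum (b * t)) fun k => norm_dysonTerm_le hS hb x k ht).trans ?_
    rw [mul_comm]

theorem IsDuhamel.continuousOn_integrand {S : ℝ → E →L[ℝ] E} (hS : IsIsometryGroup S)
    {B : E →L[ℝ] E} {x : E} {u : ℝ → E} (hu : IsDuhamel S B x u) (t : ℝ) :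
    ContinuousOn (fun ρ => S (t - ρ) (B (u ρ))) (Ici 0) :=
  hS.continuous_uncurry.comp_continuousOn
    ((continuous_const.sub continuous_id).continuousOn.prodMk
      (B.continuous.comp_continuousOn hu.1))

theorem IsDuhamel.intervalIntegrable {S : ℝ → E →L[ℝ] E} (hS : IsIsometryGroup S)
    {B : E →L[ℝ] E} {x : E} {u : ℝ → E} (hu : IsDuhamel S B x u) (r : ℝ) {s t : ℝ}
    (hs : 0 ≤ s) (ht : 0 ≤ t) :
    IntervalIntegrable (fun ρ => S (r - ρ) (B (u ρ))) volume s t :=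
  ((hu.continuousOn_integrand hS r).mono fun _ hρ =>
    (le_min hs ht).trans hρ.1).intervalIntegrable

theorem IsDuhamel.unique {S : ℝ → E →L[ℝ] E} (hS : IsIsometryGroup S)
    {B : E →L[ℝ] E} {x : E} {u w : ℝ → E} (hu : IsDuhamel S B x u) (hw : IsDuhamel S B x w) :
    EqOn w u (Ici 0) := by
  intro T hT
  have hT : 0 ≤ T := hT
  obtain ⟨M, hM⟩ := (isCompact_Icc (a := 0) (b := T)).exists_bound_of_continuousOn
    ((hw.1.sub hu.1).mono Icc_subset_Ici_self)
  have hd : ∀ t, 0 ≤ t → w t - u t = ∫ ρ in (0 : ℝ)..t, S (t - ρ) (B (w ρ - u ρ)) := by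
    intro t ht
    rw [hw.2 t ht, hu.2 t ht, add_sub_add_left_eq_sub, ← intervalIntegral.integral_sub
      (hw.intervalIntegrable hS t le_rfl ht) (hu.intervalIntegrable hS t le_rfl ht)]
    simp only [map_sub]
  have hk : ∀ k : ℕ, ∀ t ∈ Icc 0 T,
      ‖w t - u t‖ ≤ M * ((‖B‖ * t) ^ k / k.factorial) := by
    intro k
    induction k with
    | zero => intro t ht; simpa using hM t ht
    | succ k ih =>
      intro t ht
      rw [hd t ht.1]
      exact norm_duhamel_integral_le hS le_rfl ht.1
        fun ρ hρ => ih ρ ⟨hρ.1, hρ.2.trans ht.2⟩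
  have hlim := (FloorSemiring.tendsto_pow_div_factorial_atTop (‖B‖ * T)).const_mul M
  rw [mul_zero] at hlim
  have h0 : ‖w T - u T‖ ≤ 0 := ge_of_tendsto' hlim fun k => hk k T ⟨hT, le_rfl⟩
  exact sub_eq_zero.1 (norm_le_zero_iff.1 h0)

theorem IsDuhamel.norm_le [CompleteSpace E] {S : ℝ → E →L[ℝ] E} (hS : IsIsometryGroup S)
    {B : E →L[ℝ] E} {b : ℝ} (hb : ‖B‖ ≤ b) {x : E} {u : ℝ → E} (hu : IsDuhamel S B x u)
    {t : ℝ} (ht : 0 ≤ t) : ‖u t‖ ≤ Real.exp (b * t) * ‖x‖ := by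
  obtain ⟨w, hw, hw'⟩ := exists_isDuhamel hS hb x
  rw [hw.unique hS hu ht]
  exact hw' t ht

/-- A solution restarted at time `t` solves the equation with the initial value `u t`. -/
theorem IsDuhamel.shift [CompleteSpace E] {S : ℝ → E →L[ℝ] E} (hS : IsIsometryGroup S)
    {B : E →L[ℝ] E} {x : E} {u : ℝ → E} (hu : IsDuhamel S B x u) {t : ℝ} (ht : 0 ≤ t) :
    IsDuhamel S B (u t) fun h => u (t + h) := by
  refine ⟨hu.1.comp (by fun_prop) fun h hh => add_nonneg ht hh, fun h hh => ?_⟩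
  beta_reduce
  rw [hu.2 (t + h) (add_nonneg ht hh), ← intervalIntegral.integral_add_adjacent_intervals
    (hu.intervalIntegrable hS _ le_rfl ht) (hu.intervalIntegrable hS _ ht (add_nonneg ht hh)),
    ← add_assoc]
  congr 1
  · rw [hu.2 t ht, map_add, add_comm t h, hS.add,
      ← (S h).intervalIntegral_comp_comm (hu.intervalIntegrable hS _ le_rfl ht)]
    simp only [← hS.add, add_sub_assoc]
  · have h1 := intervalIntegral.integral_comp_add_left (a := 0) (b := h)
      (fun ρ => S (t + h - ρ) (B (u ρ))) t
    simp only [add_sub_add_left_eq_sub, add_zero] at h1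
    exact h1.symm

/-- Solutions are transported by operators that intertwine the two groups and perturbations. -/
theorem IsDuhamel.map {F : Type*} [NormedAddCommGroup F] [NormedSpace ℝ F] [CompleteSpace E]
    [CompleteSpace F] {S : ℝ → E →L[ℝ] E} (hS : IsIsometryGroup S) {S' : ℝ → F →L[ℝ] F}
    {B : E →L[ℝ] E} {B' : F →L[ℝ] F} (J : E →L[ℝ] F) (hJS : ∀ t x, J (S t x) = S' t (J x))
    (hJB : ∀ x, J (B x) = B' (J x)) {x : E} {u : ℝ → E} (hu : IsDuhamel S B x u) :
    IsDuhamel S' B' (J x) fun t => J (u t) := by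
  refine ⟨J.continuous.comp_continuousOn hu.1, fun t ht => ?_⟩
  beta_reduce
  rw [hu.2 t ht, map_add, hJS, ← J.intervalIntegral_comp_comm
    (hu.intervalIntegrable hS t le_rfl ht)]
  simp only [hJS, hJB]

end Duhamel

/-! ### The exponential of a bounded operator -/

section OperatorExp

open NormedSpace

variable {E F : Type*} [NormedAddCommGroup E] [NormedSpace ℝ E]
  [NormedAddCommGroup F] [NormedSpace ℝ F]

theorem norm_smul_le_of_nonneg {B : E →L[ℝ] E} {b τ : ℝ} (hb : ‖B‖ ≤ b) (hτ : 0 ≤ τ) :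
    ‖τ • B‖ ≤ b * τ := by
  rw [norm_smul, Real.norm_of_nonneg hτ, mul_comm]
  gcongr

theorem norm_pow_apply_le {A : E →L[ℝ] E} {a : ℝ} (ha : ‖A‖ ≤ a) (x : E) (n : ℕ) :
    ‖(n.factorial : ℝ)⁻¹ • (A ^ n) x‖ ≤ a ^ n / n.factorial * ‖x‖ := by
  have h : ‖(A ^ n) x‖ ≤ a ^ n * ‖x‖ := by
    induction n with
    | zero => simp
    | succ n ih =>
      rw [pow_succ', mul_apply_eq_comp, pow_succ', mul_assoc]
      exact (A.le_opNorm _).trans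
        (mul_le_mul ha ih (norm_nonneg _) ((norm_nonneg _).trans ha))
  rw [norm_smul, norm_inv, Real.norm_natCast, div_eq_inv_mul, mul_assoc]
  gcongr

variable [CompleteSpace E] [CompleteSpace F]

theorem hasSum_exp_apply (A : E →L[ℝ] E) (x : E) :
    HasSum (fun n : ℕ => (n.factorial : ℝ)⁻¹ • (A ^ n) x) (exp A x) := by
  have h : HasSum (fun n : ℕ => (n.factorial : ℝ)⁻¹ • A ^ n) (exp A) := exp_series_hasSum_exp' A
  exact h.mapL (ContinuousLinearMap.apply ℝ E x)

theorem norm_exp_apply_le {A : E →L[ℝ] E} {a : ℝ} (ha : ‖A‖ ≤ a) (x : E) :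
    ‖exp A x‖ ≤ Real.exp a * ‖x‖ := by
  rw [← (hasSum_exp_apply A x).tsum_eq]
  exact tsum_of_norm_bounded ((hasSum_pow_div_factorial a).mul_right ‖x‖)
    (norm_pow_apply_le ha x)

theorem norm_exp_apply_sub_le {A : E →L[ℝ] E} {a : ℝ} (ha : ‖A‖ ≤ a) (x : E) :
    ‖exp A x - x - A x‖ ≤ a ^ 2 * Real.exp a * ‖x‖ := by
  have ha0 : 0 ≤ a := (norm_nonneg _).trans ha
  have h1 := (hasSum_nat_add_iff' 2).2 (hasSum_exp_apply A x)
  have h2 := (hasSum_nat_add_iff' 2).2 ((hasSum_pow_div_factorial a).mul_right ‖x‖)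
  have h3 := tsum_of_norm_bounded h2 fun n => norm_pow_apply_le ha x (n + 2)
  rw [h1.tsum_eq] at h3
  simp only [Finset.sum_range_succ, Finset.sum_range_zero, Nat.factorial, pow_zero, pow_one,
    zero_add, Nat.cast_one, inv_one, one_smul, mul_one, div_one, one_mul,
    one_apply_eq_self, ← sub_sub] at h3
  refine h3.trans ?_
  have h4 : 1 - a ≤ Real.exp (-a) := Real.one_sub_le_exp_neg a
  have h5 : Real.exp a * Real.exp (-a) = 1 := by rw [← Real.exp_add]; simp
  have h6 : Real.exp a ≤ 1 + a * Real.exp a := by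
    nlinarith [mul_le_mul_of_nonneg_left h4 (Real.exp_pos a).le]
  have h7 : Real.exp a - 1 - a ≤ a ^ 2 * Real.exp a := by nlinarith
  calc Real.exp a * ‖x‖ - ‖x‖ - a * ‖x‖ = (Real.exp a - 1 - a) * ‖x‖ := by ring
    _ ≤ _ := by gcongr

theorem map_exp_apply (J : E →L[ℝ] F) {A : E →L[ℝ] E} {A' : F →L[ℝ] F}
    (h : ∀ x, J (A x) = A' (J x)) (x : E) : J (exp A x) = exp A' (J x) := by
  have hn : ∀ n : ℕ, ∀ x, J ((A ^ n) x) = (A' ^ n) (J x) := by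
    intro n
    induction n with
    | zero => simp
    | succ n ih =>
      intro x
      rw [pow_succ', pow_succ', mul_apply_eq_comp, mul_apply_eq_comp, h, ih]
  refine (J.hasSum (hasSum_exp_apply A x)).unique ?_
  simp only [map_smul, hn]
  exact hasSum_exp_apply A' (J x)

end OperatorExp

/-! ### First-order convergence of the Lie–Trotter splitting -/

section Splitting

open NormedSpace

variable {E F : Type*} [NormedAddCommGroup E] [NormedSpace ℝ E] [CompleteSpace E]
  [NormedAddCommGroup F] [NormedSpace ℝ F] [CompleteSpace F]

/-- The Lie–Trotter splitting `u^{n+1} = S(τ) exp(τ B) u^n`, `u^0 = x`. -/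
noncomputable def lieSplit (S : ℝ → E →L[ℝ] E) (B : E →L[ℝ] E) (τ : ℝ) (x : E) : ℕ → E
  | 0 => x
  | n + 1 => S τ (exp (τ • B) (lieSplit S B τ x n))

theorem norm_lieSplit_le {S : ℝ → E →L[ℝ] E} (hS : IsIsometryGroup S) {B : E →L[ℝ] E} {b : ℝ}
    (hb : ‖B‖ ≤ b) {τ : ℝ} (hτ : 0 ≤ τ) (x : E) (n : ℕ) :
    ‖lieSplit S B τ x n‖ ≤ Real.exp (b * (n * τ)) * ‖x‖ := by
  induction n with
  | zero => simp [lieSplit]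
  | succ n ih =>
    rw [lieSplit, hS.norm]
    refine (norm_exp_apply_le (norm_smul_le_of_nonneg hb hτ) _).trans ?_
    calc _ ≤ Real.exp (b * τ) * (Real.exp (b * (n * τ)) * ‖x‖) := by gcongr
      _ = _ := by
        rw [← mul_assoc, ← Real.exp_add]
        congr 2
        push_cast
        ring

theorem map_lieSplit (J : E →L[ℝ] F) {S : ℝ → E →L[ℝ] E} {S' : ℝ → F →L[ℝ] F}
    {B : E →L[ℝ] E} {B' : F →L[ℝ] F} (hJS : ∀ t x, J (S t x) = S' t (J x))
    (hJB : ∀ x, J (B x) = B' (J x)) (τ : ℝ) (x : E) (n : ℕ) :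
    J (lieSplit S B τ x n) = lieSplit S' B' τ (J x) n := by
  induction n with
  | zero => rfl
  | succ n ih =>
    rw [lieSplit, lieSplit, hJS, map_exp_apply J (A' := τ • B') (fun y => by simp [hJB]), ih]

theorem continuous_lieSplit {α : Type*} [TopologicalSpace α] (S : ℝ → E →L[ℝ] E)
    {B : α → E →L[ℝ] E} (hB : Continuous B) (τ : ℝ) (x : E) (n : ℕ) :
    Continuous fun a => lieSplit S (B a) τ x n := by
  induction n with
  | zero => exact continuous_const
  | succ n ih =>
    let _ : NormedAlgebra ℚ (E →L[ℝ] E) := NormedAlgebra.restrictScalars ℚ ℝ _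
    exact (S τ).continuous.comp ((exp_continuous.comp (hB.const_smul τ)).clm_apply ih)

variable {S : ℝ → E →L[ℝ] E} {S' : ℝ → F →L[ℝ] F} {B : E →L[ℝ] E} {B' : F →L[ℝ] F}
  {J : E →L[ℝ] F} {b : ℝ}

/-- The local error of the splitting in the weak space `F`, for data in the strong space `E`. It
compares both sides with `S(τ) (x + τ B x)`; the loss of regularity enters only through the
continuity of the free flow at time zero. -/
theorem norm_local_error_le (hS : IsIsometryGroup S) (hS' : IsIsometryGroup S')
    (hJ : ∀ x, ‖J x‖ ≤ ‖x‖) (hJS : ∀ t x, J (S t x) = S' t (J x))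
    (hJB : ∀ x, J (B x) = B' (J x)) (hreg : ∀ t x, 0 ≤ t → ‖S' t (J x) - J x‖ ≤ t * ‖x‖)
    (hb : ‖B‖ ≤ b) (hb' : ‖B'‖ ≤ b) {x : E} {u : ℝ → E} (hu : IsDuhamel S B x u)
    {τ : ℝ} (hτ : 0 ≤ τ) :
    ‖J (u τ) - S' τ (exp (τ • B') (J x))‖ ≤
      τ ^ 2 * (4 * Real.exp (2 * b)) * (Real.exp (b * τ) * ‖x‖) := by
  have hb0 : 0 ≤ b := (norm_nonneg _).trans hb
  have hU := hu.map hS J hJS hJB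
  have hU2 : ∀ t, 0 ≤ t → J (u t) = S' t (J x) +
    ∫ ρ in (0 : ℝ)..t, S' (t - ρ) (B' (J (u ρ))) := hU.2
  have hbx : ∀ {ρ}, ρ ∈ Icc 0 τ → ‖J (u ρ)‖ ≤ Real.exp (b * τ) * ‖x‖ := fun {ρ} hρ =>
    (hJ _).trans ((hu.norm_le hS hb hρ.1).trans (by have := hρ.2; gcongr))
  have hx : ‖x‖ ≤ Real.exp (b * τ) * ‖x‖ :=
    le_mul_of_one_le_left (norm_nonneg _) (Real.one_le_exp (by positivity))
  set N := Real.exp (b * τ) * ‖x‖ with hN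
  have hN0 : 0 ≤ N := by positivity
  -- the solution moves by `O(τ)` in `F`
  have h1 : ∀ ρ ∈ Icc 0 τ, ‖J (u ρ) - J x‖ ≤ τ * ((1 + b) * N) := by
    intro ρ hρ
    have e : J (u ρ) - J x = (S' ρ (J x) - J x) +
        ∫ σ in (0 : ℝ)..ρ, S' (ρ - σ) (B' (J (u σ))) := by
      rw [hU2 ρ hρ.1]; abel
    rw [e]
    refine (norm_add_le _ _).trans ?_
    have h2 : ‖∫ σ in (0 : ℝ)..ρ, S' (ρ - σ) (B' (J (u σ)))‖ ≤ b * N * |ρ - 0| := by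
      refine intervalIntegral.norm_integral_le_of_norm_le_const fun σ hσ => ?_
      rw [uIoc_of_le hρ.1] at hσ
      refine (norm_duhamel_integrand_le hS' hb' _ _).trans ?_
      gcongr
      exact hbx ⟨hσ.1.le, hσ.2.trans hρ.2⟩
    rw [sub_zero, abs_of_nonneg hρ.1] at h2
    calc _ ≤ ρ * ‖x‖ + b * N * ρ := add_le_add (hreg ρ x hρ.1) h2
      _ ≤ τ * N + b * N * τ := by have := hρ.1; have := hρ.2; gcongr
      _ = _ := by ring
  -- the rectangle rule for the Duhamel integral
  have h2 : ‖∫ ρ in (0 : ℝ)..τ, (S' (τ - ρ) (B' (J (u ρ))) - S' τ (B' (J x)))‖ ≤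
      (τ * ((2 * b + b ^ 2) * N)) * |τ - 0| := by
    refine intervalIntegral.norm_integral_le_of_norm_le_const fun ρ hρ => ?_
    rw [uIoc_of_le hτ] at hρ
    have e : S' (τ - ρ) (B' (J (u ρ))) - S' τ (B' (J x)) =
        S' (τ - ρ) (B' (J (u ρ) - J x)) - S' (τ - ρ) (S' ρ (J (B x)) - J (B x)) := by
      rw [map_sub, map_sub, map_sub, ← hS'.add, sub_add_cancel, hJB]; abel
    rw [e]
    refine (norm_sub_le _ _).trans ?_
    have h3 : ‖S' (τ - ρ) (S' ρ (J (B x)) - J (B x))‖ ≤ τ * (b * N) := by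
      rw [hS'.norm]
      refine (hreg ρ (B x) hρ.1.le).trans ?_
      have := hρ.2
      gcongr
      exact (B.le_opNorm x).trans (by gcongr)
    calc _ ≤ b * (τ * ((1 + b) * N)) + τ * (b * N) := by
          refine add_le_add ((norm_duhamel_integrand_le hS' hb' _ _).trans ?_) h3
          gcongr
          exact h1 ρ ⟨hρ.1.le, hρ.2⟩
      _ = _ := by ring
  rw [intervalIntegral.integral_sub (hU.intervalIntegrable hS' τ le_rfl hτ)
    intervalIntegrable_const, intervalIntegral.integral_const, sub_zero, abs_of_nonneg hτ] at h2
  -- the Taylor remainder of the exponential in the splitting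
  have h3 : ‖S' τ (exp (τ • B') (J x) - J x - (τ • B') (J x))‖ ≤ (b * τ) ^ 2 * N := by
    rw [hS'.norm, hN, ← mul_assoc]
    refine (norm_exp_apply_sub_le (norm_smul_le_of_nonneg hb' hτ) _).trans ?_
    gcongr
    exact hJ x
  have e : J (u τ) - S' τ (exp (τ • B') (J x)) =
      ((∫ ρ in (0 : ℝ)..τ, S' (τ - ρ) (B' (J (u ρ)))) - τ • S' τ (B' (J x))) -
        S' τ (exp (τ • B') (J x) - J x - (τ • B') (J x)) := by
    rw [hU2 τ hτ, map_sub, map_sub, smul_apply, map_smul]; abel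
  rw [e]
  have hexp : b ≤ Real.exp b := by linarith [Real.add_one_le_exp b]
  have hexp1 : 1 ≤ Real.exp b := Real.one_le_exp hb0
  have hexp2 : Real.exp (2 * b) = Real.exp b ^ 2 := by rw [sq, ← Real.exp_add, two_mul]
  have hpoly : 2 * b + 2 * b ^ 2 ≤ 4 * Real.exp (2 * b) := by rw [hexp2]; nlinarith
  calc _ ≤ τ * ((2 * b + b ^ 2) * N) * τ + (b * τ) ^ 2 * N :=
        (norm_sub_le _ _).trans (add_le_add h2 h3)
    _ = τ ^ 2 * (2 * b + 2 * b ^ 2) * N := by ring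
    _ ≤ _ := by gcongr

/-- First-order convergence of the splitting in the weak space. -/
theorem norm_lieSplit_error_le (hS : IsIsometryGroup S) (hS' : IsIsometryGroup S')
    (hJ : ∀ x, ‖J x‖ ≤ ‖x‖) (hJS : ∀ t x, J (S t x) = S' t (J x))
    (hJB : ∀ x, J (B x) = B' (J x)) (hreg : ∀ t x, 0 ≤ t → ‖S' t (J x) - J x‖ ≤ t * ‖x‖)
    (hb : ‖B‖ ≤ b) (hb' : ‖B'‖ ≤ b) {x : E} {u : ℝ → E} (hu : IsDuhamel S B x u)
    {τ : ℝ} (hτ : 0 ≤ τ) (n : ℕ) :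
    ‖J (u (n * τ)) - lieSplit S' B' τ (J x) n‖ ≤
      n * (τ ^ 2 * (4 * Real.exp (2 * b)) * (Real.exp (b * (n * τ)) * ‖x‖)) := by
  have hb0 : 0 ≤ b := (norm_nonneg _).trans hb
  induction n with
  | zero => simp [lieSplit, hu.2 0 le_rfl, hS.zero]
  | succ n ih =>
    have hn : 0 ≤ (n : ℝ) * τ := by positivity
    have e : ((n + 1 : ℕ) : ℝ) * τ = n * τ + τ := by push_cast; ring
    have hloc := norm_local_error_le hS hS' hJ hJS hJB hreg hb hb' (hu.shift hS hn) hτ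
    -- propagation of the error of the previous steps
    have hprop : ‖S' τ (exp (τ • B') (J (u (n * τ)))) -
        S' τ (exp (τ • B') (lieSplit S' B' τ (J x) n))‖ ≤ Real.exp (b * τ) *
          (n * (τ ^ 2 * (4 * Real.exp (2 * b)) * (Real.exp (b * (n * τ)) * ‖x‖))) := by
      rw [← map_sub, hS'.norm, ← map_sub]
      refine (norm_exp_apply_le (norm_smul_le_of_nonneg hb' hτ) _).trans ?_
      gcongr
    have hun := hu.norm_le hS hb hn
    rw [e, lieSplit]
    refine (norm_sub_le_norm_sub_add_norm_sub _ _ _).trans ((add_le_add hloc hprop).trans ?_)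
    have hexp : Real.exp (b * (n * τ + τ)) = Real.exp (b * τ) * Real.exp (b * (n * τ)) := by
      rw [← Real.exp_add]; ring_nf
    rw [hexp]
    calc _ ≤ τ ^ 2 * (4 * Real.exp (2 * b)) *
            (Real.exp (b * τ) * (Real.exp (b * (n * τ)) * ‖x‖)) + _ := by gcongr
      _ = _ := by push_cast; ring

/-- The splitting with step `t / (N + 1)` converges to the exact solution at time `t`. -/
theorem tendsto_lieSplit (hS : IsIsometryGroup S) (hS' : IsIsometryGroup S')
    (hJ : ∀ x, ‖J x‖ ≤ ‖x‖) (hJS : ∀ t x, J (S t x) = S' t (J x))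
    (hJB : ∀ x, J (B x) = B' (J x)) (hreg : ∀ t x, 0 ≤ t → ‖S' t (J x) - J x‖ ≤ t * ‖x‖)
    (hb : ‖B‖ ≤ b) (hb' : ‖B'‖ ≤ b) {x : E} {u : ℝ → E} (hu : IsDuhamel S B x u)
    {t : ℝ} (ht : 0 ≤ t) :
    Filter.Tendsto (fun N : ℕ => lieSplit S' B' (t / (N + 1 : ℕ)) (J x) (N + 1)) Filter.atTop
      (nhds (J (u t))) := by
  rw [tendsto_iff_norm_sub_tendsto_zero]
  have hlim := (tendsto_one_div_add_atTop_nhds_zero_nat (𝕜 := ℝ)).const_mul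
    (t ^ 2 * (4 * Real.exp (2 * b)) * (Real.exp (b * t) * ‖x‖))
  rw [mul_zero] at hlim
  refine squeeze_zero (fun _ => norm_nonneg _) (fun N => ?_) hlim
  have h := norm_lieSplit_error_le hS hS' hJ hJS hJB hreg hb hb' hu
    (τ := t / (N + 1 : ℕ)) (by positivity) (N + 1)
  have hN : ((N + 1 : ℕ) : ℝ) ≠ 0 := by positivity
  rw [mul_div_cancel₀ _ hN] at h
  rw [norm_sub_rev]
  refine h.trans (le_of_eq ?_)
  push_cast at hN ⊢
  field_simp

end Splitting

/-! ### The free Schrödinger group on `L²` and on `H^r` -/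

section FreeFlow

variable {L : ℝ}

/-- The Fourier multiplier `exp(-i t (2 π k / L)² / 2)` of the free Schrödinger group. -/
noncomputable def freePhase (L : ℝ) (t : ℝ) (k : ℤ) : ℂ :=
  Complex.exp (-(Complex.I * t * (torusFreq L k : ℂ) ^ 2 / 2))

theorem freePhase_eq (t : ℝ) (k : ℤ) :
    freePhase L t k = Complex.exp (Complex.I * (-(t * torusFreq L k ^ 2 / 2) : ℝ)) := by
  unfold freePhase
  congr 1
  push_cast
  ring

theorem norm_freePhase (t : ℝ) (k : ℤ) : ‖freePhase L t k‖ = 1 := by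
  rw [freePhase_eq, mul_comm, Complex.norm_exp_ofReal_mul_I]

theorem freePhase_zero (k : ℤ) : freePhase L 0 k = 1 := by simp [freePhase]

theorem freePhase_add (s t : ℝ) (k : ℤ) :
    freePhase L (s + t) k = freePhase L s k * freePhase L t k := by
  rw [freePhase, freePhase, freePhase, ← Complex.exp_add]
  congr 1
  push_cast
  ring

theorem continuous_freePhase (k : ℤ) : Continuous fun t => freePhase L t k := by
  unfold freePhase
  fun_prop

theorem norm_freePhase_sub_one_le {t : ℝ} (ht : 0 ≤ t) (k : ℤ) :
    ‖freePhase L t k - 1‖ ≤ t * (1 + torusFreq L k ^ 2) := by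
  rw [freePhase_eq]
  refine Real.norm_exp_I_mul_ofReal_sub_one_le.trans ?_
  rw [norm_neg, Real.norm_of_nonneg (by positivity)]
  nlinarith [mul_nonneg ht (sq_nonneg (torusFreq L k))]

variable [Fact (0 < L)]

theorem repr_freeFlow (t : ℝ) (f : TorusL2 L) (k : ℤ) :
    fourierBasis.repr (freeFlow t f) k = freePhase L t k * fourierBasis.repr f k := by
  simp [freeFlow, freePhase]

theorem torusL2_ext {f g : TorusL2 L}
    (h : ∀ k, fourierBasis.repr f k = fourierBasis.repr g k) : f = g :=
  fourierBasis.repr.injective (lp.ext (funext h))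

theorem lp_norm_eq_of_coeff {a b : lp (fun _ : ℤ => ℂ) 2} (h : ∀ k, ‖a k‖ = ‖b k‖) :
    ‖a‖ = ‖b‖ :=
  le_antisymm (lp.norm_mono two_ne_zero fun k => (h k).le)
    (lp.norm_mono two_ne_zero fun k => (h k).ge)

/-- Strong continuity of a family of bounded multipliers on `ℓ²`. -/
theorem continuous_lp_of_multiplier {c : ℝ → ℤ → ℂ} (hc : ∀ k, Continuous fun t => c t k)
    (h1 : ∀ t k, ‖c t k‖ ≤ 1) (a : lp (fun _ : ℤ => ℂ) 2) {b : ℝ → lp (fun _ : ℤ => ℂ) 2}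
    (hb : ∀ t k, b t k = c t k * a k) : Continuous b := by
  rw [continuous_iff_continuousAt]
  intro t₀
  rw [ContinuousAt, tendsto_iff_norm_sub_tendsto_zero]
  have hn : ∀ t, ‖b t - b t₀‖ ^ 2 = ∑' k, ‖(c t k - c t₀ k) * a k‖ ^ 2 := by
    intro t
    have h := lp.norm_rpow_eq_tsum (p := 2) (by norm_num) (b t - b t₀)
    norm_num at h
    rw [h]
    refine tsum_congr fun k => ?_
    rw [hb, hb, sub_mul]
  have hsum : Summable fun k => 4 * ‖a k‖ ^ 2 := by
    have h := (memℓp_gen_iff (p := 2) (by norm_num)).1 (lp.memℓp a)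
    norm_num at h
    exact h.mul_left 4
  have hlim : Filter.Tendsto (fun t => ‖b t - b t₀‖ ^ 2) (nhds t₀) (nhds 0) := by
    simp only [hn]
    rw [show (0 : ℝ) = ∑' k : ℤ, 0 by simp]
    refine tendsto_tsum_of_dominated_convergence hsum (fun k => ?_)
      (Filter.Eventually.of_forall fun t k => ?_)
    · have : Continuous fun t => ‖(c t k - c t₀ k) * a k‖ ^ 2 :=
        ((((hc k).sub continuous_const).mul continuous_const).norm).pow 2
      simpa using this.tendsto t₀
    · rw [Real.norm_of_nonneg (by positivity), norm_mul, mul_pow]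
      gcongr
      calc ‖c t k - c t₀ k‖ ^ 2 ≤ (1 + 1) ^ 2 := by
            gcongr
            exact (norm_sub_le _ _).trans (add_le_add (h1 t k) (h1 t₀ k))
        _ = 4 := by norm_num
  have h := hlim.sqrt
  simpa [Real.sqrt_sq] using h

theorem torusL2_coe_smul (c : ℝ) (f : TorusL2 L) : (c : ℂ) • f = c • f :=
  algebraMap_smul ℂ c f

/-- The free flow on `L²` as a bounded operator. -/
noncomputable def freeFlowL2 (L : ℝ) [Fact (0 < L)] (t : ℝ) : TorusL2 L →L[ℝ] TorusL2 L :=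
  LinearMap.mkContinuous
    { toFun := freeFlow t
      map_add' := fun f g => torusL2_ext fun k => by
        simp only [repr_freeFlow, map_add, lp.coeFn_add, Pi.add_apply, mul_add]
      map_smul' := fun r f => torusL2_ext fun k => by
        simp only [← torusL2_coe_smul, RingHom.id_apply, repr_freeFlow, map_smul,
          lp.coeFn_smul, Pi.smul_apply, smul_eq_mul, mul_left_comm] }
    1 fun f => by
      rw [one_mul, ← fourierBasis.repr.norm_map, ← fourierBasis.repr.norm_map f]
      refine (lp_norm_eq_of_coeff fun k => ?_).le
      change ‖fourierBasis.repr (freeFlow t f) k‖ = _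
      rw [repr_freeFlow, norm_mul, norm_freePhase, one_mul]

@[simp]
theorem freeFlowL2_apply (t : ℝ) (f : TorusL2 L) : freeFlowL2 L t f = freeFlow t f := rfl

theorem freeFlow_zero (f : TorusL2 L) : freeFlow 0 f = f :=
  torusL2_ext fun k => by rw [repr_freeFlow, freePhase_zero, one_mul]

theorem freeFlow_add (s t : ℝ) (f : TorusL2 L) :
    freeFlow (s + t) f = freeFlow s (freeFlow t f) :=
  torusL2_ext fun k => by simp only [repr_freeFlow, freePhase_add, mul_assoc]

theorem freeFlow_smul (t : ℝ) (c : ℂ) (f : TorusL2 L) :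
    freeFlow t (c • f) = c • freeFlow t f :=
  torusL2_ext fun k => by
    simp only [repr_freeFlow, map_smul, lp.coeFn_smul, Pi.smul_apply, smul_eq_mul, mul_left_comm]

theorem isIsometryGroup_freeFlowL2 : IsIsometryGroup (freeFlowL2 L) where
  zero f := freeFlow_zero (L := L) f
  add s t f := by simp only [freeFlowL2_apply, freeFlow_add]
  norm t f := by
    rw [freeFlowL2_apply, ← fourierBasis.repr.norm_map, ← fourierBasis.repr.norm_map f]
    refine lp_norm_eq_of_coeff fun k => ?_
    rw [repr_freeFlow, norm_mul, norm_freePhase, one_mul]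
  cont f := by
    have h := continuous_lp_of_multiplier (c := freePhase L) continuous_freePhase
      (fun t k => (norm_freePhase t k).le) (fourierBasis.repr f)
      (b := fun t => fourierBasis.repr (freeFlow t f)) fun t k => repr_freeFlow t f k
    simpa [Function.comp_def] using (fourierBasis (T := L)).repr.symm.continuous.comp h

end FreeFlow

namespace SobolevSpace

variable {L : ℝ} {q r : ℝ}

theorem one_le_sobolevWeight (hr : 0 ≤ r) (k : ℤ) : 1 ≤ sobolevWeight L r k :=
  Real.one_le_rpow (by nlinarith [sq_nonneg (torusFreq L k)]) hr

theorem sobolevWeight_mono (h : q ≤ r) (k : ℤ) : sobolevWeight L q k ≤ sobolevWeight L r k :=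
  Real.rpow_le_rpow_of_exponent_le (by nlinarith [sq_nonneg (torusFreq L k)]) h

variable [Fact (0 < L)]

theorem toL2_injective : Function.Injective (toL2 (L := L) (r := r)) :=
  Subtype.val_injective

theorem ext_ae {f g : SobolevSpace L r} (h : f.toL2 =ᵐ[AddCircle.haarAddCircle] g.toL2) : f = g :=
  toL2_injective (Lp.ext h)

theorem toL2_add (f g : SobolevSpace L r) : (f + g).toL2 = f.toL2 + g.toL2 := map_add toL2 f g

theorem toL2_sub (f g : SobolevSpace L r) : (f - g).toL2 = f.toL2 - g.toL2 := map_sub toL2 f g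

theorem toL2_real_smul (c : ℝ) (f : SobolevSpace L r) : (c • f).toL2 = c • f.toL2 := by
  rw [← Complex.coe_smul c f, map_smul, torusL2_coe_smul]

theorem norm_eq_norm_weightedCoeff (f : SobolevSpace L r) : ‖f‖ = ‖f.weightedCoeff‖ := rfl

theorem weightedCoeff_apply (f : SobolevSpace L r) (k : ℤ) :
    f.weightedCoeff k = (sobolevWeight L (r / 2) k : ℂ) * fourierBasis.repr f.toL2 k := rfl

theorem norm_weightedCoeff_apply (f : SobolevSpace L r) (k : ℤ) :
    ‖f.weightedCoeff k‖ = sobolevWeight L (r / 2) k * ‖fourierBasis.repr f.toL2 k‖ := by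
  rw [weightedCoeff_apply, norm_mul, Complex.norm_real,
    Real.norm_of_nonneg (sobolevWeight_pos _ _ _).le]

/-- An `L²` function whose weighted Fourier coefficients are dominated by an `ℓ²` sequence belongs
to `H^r`. -/
theorem memSobolev_of_coeff_le {f : TorusL2 L} (a : lp (fun _ : ℤ => ℝ) 2)
    (h : ∀ k, sobolevWeight L (r / 2) k * ‖fourierBasis.repr f k‖ ≤ a k) :
    MemSobolev r (f : AddCircle L → ℂ) := by
  rw [memSobolev_coe_iff]
  refine (lp.memℓp a).mono fun k => ?_
  rw [norm_mul, Complex.norm_real, Real.norm_of_nonneg (sobolevWeight_pos _ _ _).le]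
  exact h k

theorem norm_le_of_coeff_le (f : SobolevSpace L r) (a : lp (fun _ : ℤ => ℝ) 2)
    (h : ∀ k, sobolevWeight L (r / 2) k * ‖fourierBasis.repr f.toL2 k‖ ≤ a k) :
    ‖f‖ ≤ ‖a‖ := by
  rw [norm_eq_norm_weightedCoeff]
  refine lp.norm_mono two_ne_zero fun k => ?_
  rw [norm_weightedCoeff_apply]
  exact (h k).trans (le_abs_self _)

/-- The sequence `(|a_k|)` of absolute values of the weighted Fourier coefficients. -/
noncomputable def absCoeff (f : SobolevSpace L r) : lp (fun _ : ℤ => ℝ) 2 :=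
  lp.toNorm f.weightedCoeff

theorem absCoeff_apply (f : SobolevSpace L r) (k : ℤ) :
    f.absCoeff k = sobolevWeight L (r / 2) k * ‖fourierBasis.repr f.toL2 k‖ :=
  norm_weightedCoeff_apply f k

theorem norm_absCoeff (f : SobolevSpace L r) : ‖f.absCoeff‖ = ‖f‖ := lp.norm_toNorm

theorem norm_toL2_le (hr : 0 ≤ r) (f : SobolevSpace L r) : ‖f.toL2‖ ≤ ‖f‖ := by
  rw [← fourierBasis.repr.norm_map, norm_eq_norm_weightedCoeff]
  refine lp.norm_mono two_ne_zero fun k => ?_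
  rw [norm_weightedCoeff_apply]
  exact le_mul_of_one_le_left (norm_nonneg _) (one_le_sobolevWeight (by linarith) k)

theorem weightedCoeff_surjective (hr : 0 ≤ r) :
    Function.Surjective (weightedCoeff (L := L) (r := r)) := by
  intro a
  have hmem : Memℓp (fun k : ℤ => ((sobolevWeight L (r / 2) k)⁻¹ : ℂ) * a k) 2 := by
    refine (lp.memℓp a).mono' fun k => ?_
    rw [norm_mul, norm_inv, Complex.norm_real, Real.norm_of_nonneg (sobolevWeight_pos _ _ _).le]
    exact mul_le_of_le_one_left (norm_nonneg _)
      (inv_le_one_of_one_le₀ (one_le_sobolevWeight (by linarith) k))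
  have hcoeff : ∀ k, (sobolevWeight L (r / 2) k : ℂ) * fourierBasis.repr
      (fourierBasis.repr.symm ⟨_, hmem⟩ : TorusL2 L) k = a k := by
    intro k
    rw [LinearIsometryEquiv.apply_symm_apply]
    exact mul_inv_cancel_left₀ (Complex.ofReal_ne_zero.2 (sobolevWeight_pos _ _ _).ne') _
  refine ⟨SobolevSpace.mk (fourierBasis.repr.symm ⟨_, hmem⟩)
    ((memSobolev_coe_iff r _).2 ?_), lp.ext (funext hcoeff)⟩
  simp only [hcoeff]
  exact lp.memℓp a

theorem isometry_weightedCoeff : Isometry (weightedCoeff (L := L) (r := r)) :=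
  AddMonoidHomClass.isometry_of_norm _ fun _ => rfl

theorem completeSpace (hr : 0 ≤ r) : CompleteSpace (SobolevSpace L r) := by
  rw [completeSpace_iff_isComplete_range
    (isometry_weightedCoeff (L := L) (r := r)).isUniformInducing |>.trans (by
      rw [(weightedCoeff_surjective hr).range_eq])]
  exact isComplete_univ

/-- The inclusion `H^r ⊆ L²` as a real-linear map. -/
noncomputable def toL2Real : SobolevSpace L r →ₗ[ℝ] TorusL2 L where
  toFun := toL2
  map_add' := map_add _
  map_smul' := toL2_real_smul

/-- The inclusion `H^r ⊆ L²` as a bounded operator. -/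
noncomputable def toL2CLM (L : ℝ) [Fact (0 < L)] (hr : 0 ≤ r) : SobolevSpace L r →L[ℝ] TorusL2 L :=
  toL2Real.mkContinuous 1 fun f => by
    rw [one_mul]
    exact norm_toL2_le hr f

/-- A linear map into `L²` whose values have weighted Fourier coefficients dominated by `ℓ²`
sequences is a bounded operator into `H^q`. -/
noncomputable def ofCoeffBound (A : SobolevSpace L r →ₗ[ℝ] TorusL2 L) (c : ℝ)
    (a : SobolevSpace L r → lp (fun _ : ℤ => ℝ) 2)
    (h : ∀ f k, sobolevWeight L (q / 2) k * ‖fourierBasis.repr (A f) k‖ ≤ a f k)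
    (ha : ∀ f, ‖a f‖ ≤ c * ‖f‖) : SobolevSpace L r →L[ℝ] SobolevSpace L q :=
  LinearMap.mkContinuous
    { toFun := fun f => SobolevSpace.mk (A f) (memSobolev_of_coeff_le (a f) (h f))
      map_add' := fun f g => by
        apply toL2_injective
        rw [toL2_add]
        exact A.map_add f g
      map_smul' := fun c f => by
        apply toL2_injective
        rw [toL2_real_smul]
        exact A.map_smul c f }
    c fun f => (norm_le_of_coeff_le (SobolevSpace.mk (A f) (memSobolev_of_coeff_le (a f) (h f)))
      (a f) (h f)).trans (ha f)

theorem toL2_ofCoeffBound (A : SobolevSpace L r →ₗ[ℝ] TorusL2 L) (c : ℝ)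
    (a : SobolevSpace L r → lp (fun _ : ℤ => ℝ) 2)
    (h : ∀ f k, sobolevWeight L (q / 2) k * ‖fourierBasis.repr (A f) k‖ ≤ a f k)
    (ha : ∀ f, ‖a f‖ ≤ c * ‖f‖) (f : SobolevSpace L r) :
    (ofCoeffBound A c a h ha f).toL2 = A f := rfl

theorem norm_ofCoeffBound_le {A : SobolevSpace L r →ₗ[ℝ] TorusL2 L} {c : ℝ} (hc : 0 ≤ c)
    (a : SobolevSpace L r → lp (fun _ : ℤ => ℝ) 2)
    (h : ∀ f k, sobolevWeight L (q / 2) k * ‖fourierBasis.repr (A f) k‖ ≤ a f k)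
    (ha : ∀ f, ‖a f‖ ≤ c * ‖f‖) : ‖ofCoeffBound A c a h ha‖ ≤ c :=
  LinearMap.mkContinuous_norm_le _ hc _

theorem coeff_le_absCoeff (h : q ≤ r) (f : SobolevSpace L r) (k : ℤ) :
    sobolevWeight L (q / 2) k * ‖fourierBasis.repr f.toL2 k‖ ≤ f.absCoeff k := by
  rw [absCoeff_apply]
  gcongr
  exact sobolevWeight_mono (by linarith) k

/-- The inclusion `H^r ⊆ H^q` for `q ≤ r` as a bounded operator. -/
noncomputable def embed (L : ℝ) [Fact (0 < L)] (h : q ≤ r) :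
    SobolevSpace L r →L[ℝ] SobolevSpace L q :=
  ofCoeffBound toL2Real 1 absCoeff (coeff_le_absCoeff h) fun f => by rw [norm_absCoeff, one_mul]

@[simp]
theorem toL2_embed (h : q ≤ r) (f : SobolevSpace L r) : (embed L h f).toL2 = f.toL2 :=
  toL2_ofCoeffBound _ _ _ _ _ f

theorem norm_embed_le (h : q ≤ r) (f : SobolevSpace L r) : ‖embed L h f‖ ≤ ‖f‖ := by
  rw [← norm_absCoeff f]
  refine norm_le_of_coeff_le (embed L h f) f.absCoeff fun k => ?_
  rw [toL2_embed]
  exact coeff_le_absCoeff h f k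

theorem coeff_freeFlow_eq (t : ℝ) (f : SobolevSpace L r) (k : ℤ) :
    sobolevWeight L (r / 2) k * ‖fourierBasis.repr (freeFlow t f.toL2) k‖ = f.absCoeff k := by
  rw [absCoeff_apply, repr_freeFlow, norm_mul, norm_freePhase, one_mul]

/-- The free flow on `H^r` as a bounded operator. -/
noncomputable def flow (L : ℝ) [Fact (0 < L)] (r t : ℝ) : SobolevSpace L r →L[ℝ] SobolevSpace L r :=
  ofCoeffBound ((freeFlowL2 L t).toLinearMap ∘ₗ toL2Real) 1 absCoeff
    (fun f k => (coeff_freeFlow_eq t f k).le) fun f => by rw [norm_absCoeff, one_mul]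

@[simp]
theorem toL2_flow (t : ℝ) (f : SobolevSpace L r) : (flow L r t f).toL2 = freeFlow t f.toL2 :=
  toL2_ofCoeffBound _ _ _ _ _ f

theorem embed_flow (h : q ≤ r) (t : ℝ) (f : SobolevSpace L r) :
    embed L h (flow L r t f) = flow L q t (embed L h f) := by
  apply toL2_injective
  rw [toL2_embed, toL2_flow, toL2_flow, toL2_embed]

theorem isIsometryGroup_flow : IsIsometryGroup (flow L r) where
  zero f := toL2_injective (by simp [freeFlow_zero])
  add s t f := toL2_injective (by simp [freeFlow_add])
  norm t f := by
    rw [norm_eq_norm_weightedCoeff, norm_eq_norm_weightedCoeff]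
    refine lp_norm_eq_of_coeff fun k => ?_
    rw [norm_weightedCoeff_apply, norm_weightedCoeff_apply, toL2_flow, repr_freeFlow, norm_mul,
      norm_freePhase, one_mul]
  cont f := by
    rw [(isometry_weightedCoeff (L := L) (r := r)).isEmbedding.continuous_iff]
    refine continuous_lp_of_multiplier (c := freePhase L) continuous_freePhase
      (fun t k => (norm_freePhase t k).le) f.weightedCoeff fun t k => ?_
    rw [Function.comp_apply, weightedCoeff_apply, weightedCoeff_apply, toL2_flow, repr_freeFlow,
      mul_left_comm]

/-- The free flow is Lipschitz in time at the cost of two derivatives. -/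
theorem norm_flow_sub_le (h : q + 2 ≤ r) {t : ℝ} (ht : 0 ≤ t) (f : SobolevSpace L r) :
    ‖flow L q t (embed L (by linarith) f) - embed L (by linarith) f‖ ≤ t * ‖f‖ := by
  have h1 := norm_le_of_coeff_le 
    (flow L q t (embed L (by linarith) f) - embed L (by linarith) f) (t • f.absCoeff) ?_
  · rwa [norm_smul, Real.norm_of_nonneg ht, norm_absCoeff] at h1
  · intro k
    have e : fourierBasis.repr (freeFlow t f.toL2 - f.toL2) k =
        (freePhase L t k - 1) * fourierBasis.repr f.toL2 k := by
      rw [map_sub, lp.coeFn_sub, Pi.sub_apply, repr_freeFlow]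
      ring
    have hw : sobolevWeight L (q / 2) k * (1 + torusFreq L k ^ 2) ≤ sobolevWeight L (r / 2) k := by
      refine le_trans (le_of_eq ?_) (sobolevWeight_mono (q := q / 2 + 1) (by linarith) k)
      rw [sobolevWeight, sobolevWeight, Real.rpow_add (by positivity), Real.rpow_one]
    rw [map_sub, toL2_flow, toL2_embed, e, norm_mul, lp.coeFn_smul, Pi.smul_apply, smul_eq_mul,
      absCoeff_apply]
    have h0 := (sobolevWeight_pos L (q / 2) k).le
    calc _ ≤ sobolevWeight L (q / 2) k *
          (t * (1 + torusFreq L k ^ 2) * ‖fourierBasis.repr f.toL2 k‖) := by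
          gcongr
          exact norm_freePhase_sub_one_le ht k
      _ = t * ((sobolevWeight L (q / 2) k * (1 + torusFreq L k ^ 2)) *
          ‖fourierBasis.repr f.toL2 k‖) := by ring
      _ ≤ _ := by gcongr

theorem toSobolev_eq_of_ae_eq {f : AddCircle L → ℂ} (g : SobolevSpace L r)
    (h : f =ᵐ[AddCircle.haarAddCircle] g.toL2) : MemSobolev r f ∧ toSobolev r f = g := by
  have hmem : MemSobolev r f :=
    ⟨(memLp_congr_ae h).2 g.memSobolev.1, by
      simpa only [fourierCoeff_congr_ae h] using g.memSobolev.2⟩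
  refine ⟨hmem, toL2_injective ?_⟩
  rw [toSobolev, dif_pos hmem]
  exact Lp.ext (hmem.1.coeFn_toLp.trans h)

end SobolevSpace

/-! ### Multiplication operators on `L²` -/

section MulL2

variable {L : ℝ} [Fact (0 < L)]

theorem memLp_continuous_mul (g : C(AddCircle L, ℂ)) (f : TorusL2 L) :
    MemLp (fun x => g x * f x) 2 (AddCircle.haarAddCircle : Measure (AddCircle L)) := by
  refine (Lp.memLp f).of_le_mul (c := ‖g‖)
    (g.continuous.aestronglyMeasurable.mul (Lp.aestronglyMeasurable f))
    (Filter.Eventually.of_forall fun x => ?_)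
  rw [norm_mul]
  gcongr
  exact g.norm_coe_le_norm x

theorem coeFn_mulL2 (g : C(AddCircle L, ℂ)) (f : TorusL2 L) :
    mulL2 g f =ᵐ[AddCircle.haarAddCircle] fun x => g x * f x := by
  rw [mulL2, dif_pos (memLp_continuous_mul g f)]
  exact MemLp.coeFn_toLp _

theorem mulL2_congr {g g' : AddCircle L → ℂ} (h : g =ᵐ[AddCircle.haarAddCircle] g')
    (f : TorusL2 L) : mulL2 g f = mulL2 g' f := by
  have h' : (fun x => g x * f x) =ᵐ[AddCircle.haarAddCircle] fun x => g' x * f x := by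
    filter_upwards [h] with x hx
    rw [hx]
  unfold mulL2
  by_cases hg : MemLp (fun x => g x * f x) 2 (AddCircle.haarAddCircle : Measure (AddCircle L))
  · rw [dif_pos hg, dif_pos ((memLp_congr_ae h').1 hg)]
    exact MemLp.toLp_congr _ _ h'
  · rw [dif_neg hg, dif_neg fun hg' => hg ((memLp_congr_ae h').2 hg')]

theorem norm_mulL2_le (g : C(AddCircle L, ℂ)) (f : TorusL2 L) : ‖mulL2 g f‖ ≤ ‖g‖ * ‖f‖ := by
  refine Lp.norm_le_mul_norm_of_ae_le_mul ?_
  filter_upwards [coeFn_mulL2 g f] with x hx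
  rw [hx, norm_mul]
  gcongr
  exact g.norm_coe_le_norm x

theorem mulL2_add_right (g : C(AddCircle L, ℂ)) (f f' : TorusL2 L) :
    mulL2 g (f + f') = mulL2 g f + mulL2 g f' := by
  refine Lp.ext ?_
  filter_upwards [coeFn_mulL2 g f, coeFn_mulL2 g f', coeFn_mulL2 g (f + f'), Lp.coeFn_add f f',
    Lp.coeFn_add (mulL2 g f) (mulL2 g f')] with x h1 h2 h3 h4 h5
  simp only [h1, h2, h3, h4, h5, Pi.add_apply, mul_add]

theorem mulL2_smul_right (g : C(AddCircle L, ℂ)) (c : ℂ) (f : TorusL2 L) :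
    mulL2 g (c • f) = c • mulL2 g f := by
  refine Lp.ext ?_
  filter_upwards [coeFn_mulL2 g f, coeFn_mulL2 g (c • f), Lp.coeFn_smul c f,
    Lp.coeFn_smul c (mulL2 g f)] with x h1 h2 h3 h4
  simp only [h1, h2, h3, h4, Pi.smul_apply, smul_eq_mul, mul_left_comm]

theorem mulL2_add_left (g g' : C(AddCircle L, ℂ)) (f : TorusL2 L) :
    mulL2 (g + g') f = mulL2 g f + mulL2 g' f := by
  refine Lp.ext ?_
  filter_upwards [coeFn_mulL2 g f, coeFn_mulL2 g' f, coeFn_mulL2 (g + g') f,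
    Lp.coeFn_add (mulL2 g f) (mulL2 g' f)] with x h1 h2 h3 h4
  simp only [h1, h2, h3, h4, Pi.add_apply, ContinuousMap.add_apply,
    add_mul]

theorem mulL2_smul_left (c : ℂ) (g : C(AddCircle L, ℂ)) (f : TorusL2 L) :
    mulL2 (c • g) f = c • mulL2 g f := by
  refine Lp.ext ?_
  filter_upwards [coeFn_mulL2 g f, coeFn_mulL2 (c • g) f,
    Lp.coeFn_smul c (mulL2 g f)] with x h1 h2 h3
  simp only [h1, h2, h3, Pi.smul_apply, ContinuousMap.smul_apply,
    smul_eq_mul, mul_assoc]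

theorem mulL2_mul_left (g g' : C(AddCircle L, ℂ)) (f : TorusL2 L) :
    mulL2 (g * g') f = mulL2 g (mulL2 g' f) := by
  refine Lp.ext ?_
  filter_upwards [coeFn_mulL2 g (mulL2 g' f), coeFn_mulL2 g' f,
    coeFn_mulL2 (g * g') f] with x h1 h2 h3
  simp only [h1, h2, h3, ContinuousMap.mul_apply, mul_assoc]

theorem mulL2_one_left (f : TorusL2 L) : mulL2 (1 : C(AddCircle L, ℂ)) f = f := by
  refine Lp.ext ?_
  filter_upwards [coeFn_mulL2 (1 : C(AddCircle L, ℂ)) f] with x h1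
  rw [h1]
  simp

/-- Multiplication by a continuous function as a bounded operator on `L²`. -/
noncomputable def mulOp (g : C(AddCircle L, ℂ)) : TorusL2 L →L[ℝ] TorusL2 L :=
  LinearMap.mkContinuous
    { toFun := mulL2 g
      map_add' := mulL2_add_right g
      map_smul' := fun c f => by
        rw [← torusL2_coe_smul, mulL2_smul_right, torusL2_coe_smul, RingHom.id_apply] }
    ‖g‖ (norm_mulL2_le g)

@[simp]
theorem mulOp_apply (g : C(AddCircle L, ℂ)) (f : TorusL2 L) : mulOp g f = mulL2 g f := rfl

/-- The homomorphism that sends a continuous function to the operator of multiplication by it. -/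
noncomputable def mulOpHom (L : ℝ) [Fact (0 < L)] :
    C(AddCircle L, ℂ) →+* (TorusL2 L →L[ℝ] TorusL2 L) where
  toFun := mulOp
  map_zero' := by
    ext1 f
    have h := mulL2_smul_left (0 : ℂ) (0 : C(AddCircle L, ℂ)) f
    rw [zero_smul, zero_smul] at h
    exact h
  map_one' := ContinuousLinearMap.ext mulL2_one_left
  map_add' g g' := ContinuousLinearMap.ext (mulL2_add_left g g')
  map_mul' g g' := ContinuousLinearMap.ext (mulL2_mul_left g g')

theorem norm_mulOp_le (g : C(AddCircle L, ℂ)) : ‖mulOp g‖ ≤ ‖g‖ :=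
  LinearMap.mkContinuous_norm_le _ (norm_nonneg _) _

theorem continuous_mulOpHom : Continuous (mulOpHom L) :=
  AddMonoidHomClass.continuous_of_bound (mulOpHom L) 1 fun g => by
    rw [one_mul]
    exact norm_mulOp_le g

theorem coe_exp_continuousMap (g : C(AddCircle L, ℂ)) (x : AddCircle L) :
    NormedSpace.exp g x = Complex.exp (g x) := by
  let _ : NormedAlgebra ℚ C(AddCircle L, ℂ) := NormedAlgebra.restrictScalars ℚ ℂ _
  rw [Complex.exp_eq_exp_ℂ]
  exact NormedSpace.map_exp (ContinuousMap.evalAlgHom ℂ ℂ x) (continuous_eval_const x)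
    g

/-- The exponential of a multiplication operator is multiplication by the exponential. -/
theorem exp_mulOp_apply (g : C(AddCircle L, ℂ)) (f : TorusL2 L) :
    NormedSpace.exp (mulOp g) f = mulL2 (fun x => Complex.exp (g x)) f := by
  let _ : NormedAlgebra ℚ C(AddCircle L, ℂ) := NormedAlgebra.restrictScalars ℚ ℂ _
  let _ : NormedAlgebra ℚ (TorusL2 L →L[ℝ] TorusL2 L) := NormedAlgebra.restrictScalars ℚ ℝ _
  have h := NormedSpace.map_exp (mulOpHom L) continuous_mulOpHom g
  have h2 : NormedSpace.exp (mulOp g) = mulOp (NormedSpace.exp g) := h.symm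
  rw [h2, mulOp_apply]
  congr 1
  funext x
  exact coe_exp_continuousMap g x

theorem mulL2_fourier_coeff (l : ℤ) (f : TorusL2 L) (k : ℤ) :
    fourierBasis.repr (mulL2 (fourier l : C(AddCircle L, ℂ)) f) k =
      fourierBasis.repr f (k - l) := by
  rw [fourierBasis_repr, fourierBasis_repr, fourierCoeff, fourierCoeff]
  refine integral_congr_ae ?_
  filter_upwards [coeFn_mulL2 (fourier l : C(AddCircle L, ℂ)) f] with x hx
  rw [hx, smul_eq_mul, smul_eq_mul, ← mul_assoc, ← fourier_add]
  congr 3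
  ring

theorem hasSum_coeff_mulL2 {α : ℤ → ℂ} {g : C(AddCircle L, ℂ)}
    (h : HasSum (fun l => α l • (fourier l : C(AddCircle L, ℂ))) g) (f : TorusL2 L) (k : ℤ) :
    HasSum (fun l => α l * fourierBasis.repr f (k - l)) (fourierBasis.repr (mulL2 g f) k) := by
  have h1 : HasSum (fun l => mulOp (α l • (fourier l : C(AddCircle L, ℂ))) f) (mulOp g f) :=
    (h.map (mulOpHom L) continuous_mulOpHom).mapL (ContinuousLinearMap.apply ℝ (TorusL2 L) f)
  have h2 := h1.map (fourierBasis (T := L)).repr.toAddEquiv (fourierBasis (T := L)).repr.continuous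
  have h3 := h2.map (lp.coeFnAddMonoidHom (fun _ : ℤ => ℂ) 2)
    (lp.uniformContinuous_coe (p := 2)).continuous
  have h4 := Pi.hasSum.1 h3 k
  have h5 : HasSum _ (fourierBasis.repr (mulL2 g f) k) := h4
  convert h5 using 2 with l
  change α l * _ = fourierBasis.repr (mulL2 ((α l • fourier l : C(AddCircle L, ℂ))) f) k
  rw [mulL2_smul_left, map_smul, lp.coeFn_smul, Pi.smul_apply, mulL2_fourier_coeff, smul_eq_mul]

end MulL2

/-! ### Convolution of an `ℓ¹` with an `ℓ²` sequence -/

section Convolution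

theorem memℓp_shift (a : lp (fun _ : ℤ => ℝ) 2) (l : ℤ) : Memℓp (fun k => a (k - l)) 2 := by
  have h := lp.memℓp a
  rw [memℓp_gen_iff (by norm_num)] at h ⊢
  exact (Equiv.subRight l).summable_iff.2 h

/-- The shift `(a_{k - l})_k` of a sequence. -/
noncomputable def shiftLp (l : ℤ) (a : lp (fun _ : ℤ => ℝ) 2) : lp (fun _ : ℤ => ℝ) 2 :=
  ⟨fun k => a (k - l), memℓp_shift a l⟩

theorem norm_shiftLp (l : ℤ) (a : lp (fun _ : ℤ => ℝ) 2) : ‖shiftLp l a‖ = ‖a‖ := by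
  rw [lp.norm_eq_tsum_rpow (by norm_num), lp.norm_eq_tsum_rpow (by norm_num)]
  congr 1
  exact (Equiv.subRight l).tsum_eq fun k => ‖a k‖ ^ (2 : ENNReal).toReal

/-- Young's inequality `‖α * a‖₂ ≤ ‖α‖₁ ‖a‖₂`: the convolution is an absolutely convergent sum of
shifts of `a`. -/
theorem exists_convolution {α : ℤ → ℝ} {A : ℝ} (hα : HasSum (fun l => ‖α l‖) A)
    (a : lp (fun _ : ℤ => ℝ) 2) :
    ∃ b : lp (fun _ : ℤ => ℝ) 2, (∀ k, HasSum (fun l => α l * a (k - l)) (b k)) ∧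
      ‖b‖ ≤ A * ‖a‖ := by
  have hn : ∀ l, ‖α l • shiftLp l a‖ ≤ ‖α l‖ * ‖a‖ := fun l => by
    rw [norm_smul, norm_shiftLp]
  have hA := hα.mul_right ‖a‖
  refine ⟨∑' l, α l • shiftLp l a, fun k => ?_, tsum_of_norm_bounded hA hn⟩
  have h := (Summable.of_norm_bounded hA.summable hn).hasSum
  exact Pi.hasSum.1 (h.map (lp.coeFnAddMonoidHom (fun _ : ℤ => ℝ) 2)
    (lp.uniformContinuous_coe (p := 2)).continuous) k

end Convolution

/-! ### `H^r` is an algebra for `r ≥ 1` -/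

namespace SobolevSpace

theorem summable_sobolevWeight_neg {L : ℝ} (hL : 0 < L) {r : ℝ} (hr : 1 ≤ r) :
    Summable fun k => sobolevWeight L (-r) k := by
  have h1 : Summable fun k : ℤ => (L / (2 * Real.pi)) ^ 2 * (1 / (k : ℝ) ^ 2) :=
    (Real.summable_one_div_int_pow.2 one_lt_two).mul_left _
  refine Summable.of_norm_bounded_eventually h1 ?_
  have hfin : {k : ℤ | ¬‖sobolevWeight L (-r) k‖ ≤
      (L / (2 * Real.pi)) ^ 2 * (1 / (k : ℝ) ^ 2)} ⊆ {0} := by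
    intro k hk
    by_contra hk0
    refine hk ?_
    rw [mem_singleton_iff] at hk0
    have hk1 : (k : ℝ) ≠ 0 := by exact_mod_cast hk0
    rw [Real.norm_of_nonneg (sobolevWeight_pos _ _ _).le]
    refine (sobolevWeight_mono (neg_le_neg hr) k).trans ?_
    rw [sobolevWeight, Real.rpow_neg_one]
    have hpos : 0 < torusFreq L k ^ 2 := by
      unfold torusFreq
      have := Real.pi_pos
      positivity
    refine (inv_anti₀ hpos (le_add_of_nonneg_left zero_le_one)).trans (le_of_eq ?_)
    unfold torusFreq
    have := Real.pi_ne_zero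
    field_simp
  exact (finite_singleton 0).subset hfin

/-- Peetre's inequality in additive form. -/
theorem sobolevWeight_le_add {L r : ℝ} (hr : 0 ≤ r) (k l : ℤ) :
    sobolevWeight L r k ≤ 4 ^ r * (sobolevWeight L r l + sobolevWeight L r (k - l)) := by
  have e : torusFreq L k = torusFreq L l + torusFreq L (k - l) := by
    unfold torusFreq
    push_cast
    ring
  have key : ∀ x y : ℝ, y ^ 2 ≤ x ^ 2 →
      (1 + (x + y) ^ 2) ^ r ≤ 4 ^ r * (1 + x ^ 2) ^ r := fun x y h => by
    rw [← Real.mul_rpow (by norm_num) (by positivity)]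
    exact Real.rpow_le_rpow (by positivity) (by nlinarith [sq_nonneg (x - y)]) hr
  have h0 := (sobolevWeight_pos L r l).le
  have h1 := (sobolevWeight_pos L r (k - l)).le
  have h4 : (0 : ℝ) ≤ 4 ^ r := by positivity
  rcases le_total (torusFreq L (k - l) ^ 2) (torusFreq L l ^ 2) with h | h
  · have := key _ _ h
    rw [← e] at this
    exact this.trans (by gcongr; exact le_add_of_nonneg_right h1)
  · have := key _ _ h
    rw [add_comm (torusFreq L (k - l)), ← e] at this
    exact this.trans (by gcongr; exact le_add_of_nonneg_left h0)

-- The condition `1 ≤ r` is carried as a `Fact`, so that completeness of `H^r` is an instance.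
variable {L : ℝ} [hL : Fact (0 < L)] {r : ℝ} [hr : Fact (1 ≤ r)]

instance : CompleteSpace (SobolevSpace L r) := completeSpace (zero_le_one.trans hr.out)

theorem memℓp_invWeight : Memℓp (fun k : ℤ => sobolevWeight L (-r / 2) k) 2 := by
  rw [memℓp_gen_iff (by norm_num)]
  refine (summable_sobolevWeight_neg hL.out hr.out).congr fun k => ?_
  rw [Real.norm_of_nonneg (sobolevWeight_pos _ _ _).le, ← sobolevWeight_half_sq]
  norm_num

/-- The `ℓ²` sequence `(1 + |2 π k / L|²)^(-r / 2)`. -/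
noncomputable def invWeight (L r : ℝ) [Fact (0 < L)] [Fact (1 ≤ r)] : lp (fun _ : ℤ => ℝ) 2 :=
  ⟨fun k => sobolevWeight L (-r / 2) k, memℓp_invWeight⟩

theorem norm_coeff_eq (f : SobolevSpace L r) (k : ℤ) :
    ‖fourierBasis.repr f.toL2 k‖ = ‖invWeight L r k‖ * ‖f.absCoeff k‖ := by
  have h1 : invWeight L r k = sobolevWeight L (-r / 2) k := rfl
  have h2 : sobolevWeight L (-r / 2) k * sobolevWeight L (r / 2) k = 1 := by
    unfold sobolevWeight
    rw [← Real.rpow_add (by positivity)]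
    ring_nf
    exact Real.rpow_zero _
  rw [absCoeff_apply, h1, norm_mul, norm_norm, Real.norm_of_nonneg (sobolevWeight_pos _ _ _).le,
    Real.norm_of_nonneg (sobolevWeight_pos _ _ _).le, ← mul_assoc, h2, one_mul]

theorem holderConjugate_two :
    (2 : ENNReal).toReal.HolderConjugate (2 : ENNReal).toReal := by
  rw [ENNReal.toReal_ofNat]
  exact Real.HolderConjugate.two_two

/-- The Fourier coefficients of `f ∈ H^r` are absolutely summable for `r ≥ 1`. -/
theorem summable_norm_coeff (f : SobolevSpace L r) :
    Summable fun k => ‖fourierBasis.repr f.toL2 k‖ := by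
  simp only [norm_coeff_eq]
  exact lp.summable_mul holderConjugate_two _ _

theorem tsum_norm_coeff_le (f : SobolevSpace L r) :
    ∑' k, ‖fourierBasis.repr f.toL2 k‖ ≤ ‖invWeight L r‖ * ‖f‖ := by
  simp only [norm_coeff_eq, ← norm_absCoeff f]
  exact lp.tsum_mul_le_mul_norm' holderConjugate_two _ _

/-- The continuous representative of `f ∈ H^r` for `r ≥ 1`, the sum of its Fourier series. -/
noncomputable def contRep (f : SobolevSpace L r) : C(AddCircle L, ℂ) :=
  ∑' k, fourierBasis.repr f.toL2 k • fourier k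

theorem hasSum_contRep (f : SobolevSpace L r) :
    HasSum (fun k => fourierBasis.repr f.toL2 k • (fourier k : C(AddCircle L, ℂ))) f.contRep := by
  refine Summable.hasSum (Summable.of_norm ?_)
  simp only [norm_smul, fourier_norm, mul_one]
  exact summable_norm_coeff f

theorem contRep_ae_eq (f : SobolevSpace L r) :
    f.contRep =ᵐ[AddCircle.haarAddCircle] f.toL2 := by
  have h1 := f.hasSum_contRep.mapL (ContinuousMap.toLp (E := ℂ) 2 AddCircle.haarAddCircle ℂ)
  have h2 := hasSum_fourier_series_L2 f.toL2
  have h3 : ContinuousMap.toLp (E := ℂ) 2 AddCircle.haarAddCircle ℂ f.contRep = f.toL2 := by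
    refine h1.unique ?_
    simp only [map_smul, fourierBasis_repr]
    exact h2
  rw [← h3]
  exact (ContinuousMap.coeFn_toLp AddCircle.haarAddCircle f.contRep).symm

theorem mulL2_toL2 (f : SobolevSpace L r) (g : TorusL2 L) : mulL2 f.toL2 g = mulL2 f.contRep g :=
  mulL2_congr f.contRep_ae_eq.symm g

theorem hasSum_norm_norm_coeff (f : SobolevSpace L r) :
    HasSum (fun l => ‖‖fourierBasis.repr f.toL2 l‖‖) (∑' k, ‖fourierBasis.repr f.toL2 k‖) := by
  simp only [norm_norm]
  exact (summable_norm_coeff f).hasSum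

/-- The constant of the algebra property of `H^r`. -/
noncomputable def mulConst (L r : ℝ) [Fact (0 < L)] [Fact (1 ≤ r)] : ℝ :=
  4 ^ (r / 2) * (2 * ‖invWeight L r‖)

theorem mulConst_nonneg : 0 ≤ mulConst L r := by
  unfold mulConst
  positivity

/-- The algebra property on the Fourier side: since `⟨k⟩^r ≲ ⟨l⟩^r + ⟨k - l⟩^r`, the weighted
coefficients of a product are dominated by two convolutions of an `ℓ¹` with an `ℓ²` sequence. -/
theorem exists_product_bound (f g : SobolevSpace L r) :
    ∃ a : lp (fun _ : ℤ => ℝ) 2,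
      (∀ k, sobolevWeight L (r / 2) k * ‖fourierBasis.repr (mulL2 f.contRep g.toL2) k‖ ≤ a k) ∧
        ‖a‖ ≤ mulConst L r * ‖f‖ * ‖g‖ := by
  obtain ⟨b₁, hb₁, hn₁⟩ := exists_convolution (hasSum_norm_norm_coeff f) g.absCoeff
  obtain ⟨b₂, hb₂, hn₂⟩ := exists_convolution (hasSum_norm_norm_coeff g) f.absCoeff
  refine ⟨(4 : ℝ) ^ (r / 2) • (b₁ + b₂), fun k => ?_, ?_⟩
  · have h2 : HasSum (fun l => ‖fourierBasis.repr g.toL2 (k - l)‖ * f.absCoeff l) (b₂ k) := by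
      rw [← (Equiv.subLeft k).hasSum_iff]
      simpa [Function.comp_def] using hb₂ k
    have h3 := ((hb₁ k).add h2).mul_left ((4 : ℝ) ^ (r / 2))
    rw [← (hasSum_coeff_mulL2 f.hasSum_contRep g.toL2 k).tsum_eq]
    have hw := (sobolevWeight_pos L (r / 2) k).le
    rw [← Real.norm_of_nonneg hw, ← Complex.norm_real, ← norm_mul, ← tsum_mul_left]
    refine tsum_of_norm_bounded h3 fun l => ?_
    have hle := sobolevWeight_le_add (L := L) (r := r / 2) (by linarith [hr.out]) k l
    rw [norm_mul, norm_mul, Complex.norm_real, Real.norm_of_nonneg hw, absCoeff_apply,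
      absCoeff_apply]
    calc _ ≤ _ := mul_le_mul_of_nonneg_right hle (by positivity)
      _ = _ := by ring
  · rw [norm_smul, Real.norm_of_nonneg (by positivity), mulConst]
    have h1 := tsum_norm_coeff_le f
    have h2 := tsum_norm_coeff_le g
    rw [norm_absCoeff] at hn₁ hn₂
    calc (4 : ℝ) ^ (r / 2) * ‖b₁ + b₂‖
        ≤ 4 ^ (r / 2) * (‖invWeight L r‖ * ‖f‖ * ‖g‖ + ‖invWeight L r‖ * ‖g‖ * ‖f‖) := by
          gcongr
          refine (norm_add_le _ _).trans (add_le_add (hn₁.trans ?_) (hn₂.trans ?_)) <;> gcongr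
      _ = _ := by ring

/-- The product of two elements of `H^r` as a bounded operator in the second factor. -/
noncomputable def mulRight (f : SobolevSpace L r) : SobolevSpace L r →L[ℝ] SobolevSpace L r :=
  ofCoeffBound ((mulOp f.contRep).toLinearMap ∘ₗ toL2Real) (mulConst L r * ‖f‖)
    (fun g => (exists_product_bound f g).choose)
    (fun g => (exists_product_bound f g).choose_spec.1)
    fun g => (exists_product_bound f g).choose_spec.2

theorem toL2_mulRight (f g : SobolevSpace L r) : (mulRight f g).toL2 = mulL2 f.contRep g.toL2 :=
  toL2_ofCoeffBound _ _ _ _ _ g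

theorem toL2_mulRight' (f g : SobolevSpace L r) : (mulRight f g).toL2 = mulL2 f.toL2 g.toL2 :=
  (toL2_mulRight f g).trans (mulL2_toL2 f g.toL2).symm

theorem mulRight_ae_eq (f g : SobolevSpace L r) :
    (mulRight f g).toL2 =ᵐ[AddCircle.haarAddCircle] fun x => f.toL2 x * g.toL2 x := by
  rw [toL2_mulRight]
  filter_upwards [coeFn_mulL2 f.contRep g.toL2, f.contRep_ae_eq] with x h1 h2
  rw [h1, h2]

theorem norm_mulRight_le (f : SobolevSpace L r) : ‖mulRight f‖ ≤ mulConst L r * ‖f‖ :=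
  norm_ofCoeffBound_le (mul_nonneg mulConst_nonneg (norm_nonneg _)) _ _ _

/-- The multiplication of `H^r` as a bounded bilinear map. -/
noncomputable def mulCLM (L r : ℝ) [Fact (0 < L)] [Fact (1 ≤ r)] :
    SobolevSpace L r →L[ℝ] SobolevSpace L r →L[ℝ] SobolevSpace L r :=
  LinearMap.mkContinuous
    { toFun := mulRight
      map_add' := fun f f' => by
        ext1 g
        refine ext_ae ?_
        rw [add_apply, toL2_add]
        filter_upwards [mulRight_ae_eq f g, mulRight_ae_eq f' g, mulRight_ae_eq (f + f') g,
          Lp.coeFn_add (mulRight f g).toL2 (mulRight f' g).toL2,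
          Lp.coeFn_add f.toL2 f'.toL2] with x h1 h2 h3 h4 h5
        rw [h3, h4, Pi.add_apply, h1, h2, toL2_add, h5, Pi.add_apply, add_mul]
      map_smul' := fun c f => by
        ext1 g
        refine ext_ae ?_
        rw [smul_apply, RingHom.id_apply, toL2_real_smul]
        filter_upwards [mulRight_ae_eq f g, mulRight_ae_eq (c • f) g,
          Lp.coeFn_smul c (mulRight f g).toL2, Lp.coeFn_smul c f.toL2] with x h1 h2 h3 h4
        rw [h2, h3, Pi.smul_apply, h1, toL2_real_smul, h4, Pi.smul_apply, smul_mul_assoc] }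
    (mulConst L r) norm_mulRight_le

@[simp]
theorem mulCLM_apply (f : SobolevSpace L r) : mulCLM L r f = mulRight f := rfl

theorem norm_mulRight_apply_le (f g : SobolevSpace L r) :
    ‖mulRight f g‖ ≤ mulConst L r * ‖f‖ * ‖g‖ :=
  ((mulRight f).le_opNorm g).trans (by gcongr; exact norm_mulRight_le f)

end SobolevSpace

/-! ### Complex conjugation and the position density -/

namespace SobolevSpace

variable {L : ℝ} [hL : Fact (0 < L)] {r : ℝ}

theorem repr_star (f : TorusL2 L) (k : ℤ) :
    fourierBasis.repr (star f) k = star (fourierBasis.repr f (-k)) := by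
  rw [fourierBasis_repr, fourierBasis_repr, fourierCoeff, fourierCoeff, Complex.star_def,
    ← integral_conj]
  refine integral_congr_ae ?_
  filter_upwards [Lp.coeFn_star f] with x hx
  rw [hx, Pi.star_apply, smul_eq_mul, smul_eq_mul, map_mul, neg_neg, fourier_neg, Complex.star_def]

theorem sobolevWeight_neg (L r : ℝ) (k : ℤ) : sobolevWeight L r (-k) = sobolevWeight L r k := by
  unfold sobolevWeight torusFreq
  push_cast
  congr 2
  ring

theorem memℓp_absCoeff_neg (f : SobolevSpace L r) : Memℓp (fun k => f.absCoeff (-k)) 2 := by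
  have h := lp.memℓp f.absCoeff
  rw [memℓp_gen_iff (by norm_num)] at h ⊢
  exact (Equiv.neg ℤ).summable_iff.2 h

theorem norm_absCoeff_neg (f : SobolevSpace L r) :
    ‖(⟨fun k => f.absCoeff (-k), memℓp_absCoeff_neg f⟩ : lp (fun _ : ℤ => ℝ) 2)‖ = ‖f‖ := by
  rw [← norm_absCoeff, lp.norm_eq_tsum_rpow (by norm_num), lp.norm_eq_tsum_rpow (by norm_num)]
  congr 1
  exact (Equiv.neg ℤ).tsum_eq fun k => ‖f.absCoeff k‖ ^ (2 : ENNReal).toReal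

/-- Complex conjugation on `L²` as a real-linear map. -/
noncomputable def starL2 (L : ℝ) [Fact (0 < L)] : TorusL2 L →ₗ[ℝ] TorusL2 L where
  toFun := star
  map_add' f g := by
    refine Lp.ext ?_
    filter_upwards [Lp.coeFn_star f, Lp.coeFn_star g, Lp.coeFn_star (f + g), Lp.coeFn_add f g,
      Lp.coeFn_add (star f) (star g)] with x h1 h2 h3 h4 h5
    rw [h3, Pi.star_apply, h4, h5, Pi.add_apply, Pi.add_apply, h1, h2, star_add]
    rfl
  map_smul' c f := by
    refine Lp.ext ?_
    filter_upwards [Lp.coeFn_star f, Lp.coeFn_star (c • f), Lp.coeFn_smul c f,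
      Lp.coeFn_smul c (star f)] with x h1 h2 h3 h4
    rw [h2, Pi.star_apply, h3, RingHom.id_apply, h4, Pi.smul_apply, Pi.smul_apply, h1]
    simp

theorem coeff_starL2_eq (f : SobolevSpace L r) (k : ℤ) :
    sobolevWeight L (r / 2) k * ‖fourierBasis.repr (starL2 L f.toL2) k‖ = f.absCoeff (-k) := by
  have h : fourierBasis.repr (starL2 L f.toL2) k = star (fourierBasis.repr f.toL2 (-k)) :=
    repr_star f.toL2 k
  rw [h, norm_star, absCoeff_apply, sobolevWeight_neg]

/-- Complex conjugation on `H^r` as a bounded real-linear operator. -/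
noncomputable def conj (L r : ℝ) [Fact (0 < L)] : SobolevSpace L r →L[ℝ] SobolevSpace L r :=
  ofCoeffBound (starL2 L ∘ₗ toL2Real) 1
    (fun f => ⟨fun k => f.absCoeff (-k), memℓp_absCoeff_neg f⟩)
    (fun f k => (coeff_starL2_eq f k).le) fun f => by rw [norm_absCoeff_neg, one_mul]

theorem toL2_conj (f : SobolevSpace L r) : (conj L r f).toL2 = star f.toL2 :=
  toL2_ofCoeffBound _ _ _ _ _ f

theorem norm_conj_le (f : SobolevSpace L r) : ‖conj L r f‖ ≤ ‖f‖ := by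
  have h : ‖conj L r‖ ≤ 1 := norm_ofCoeffBound_le zero_le_one _ _ _
  simpa using (conj L r).le_of_opNorm_le h f

variable [hr : Fact (1 ≤ r)]

/-- The position density `|f|² = f * conj f` of `f ∈ H^r` as an element of `H^r`. -/
noncomputable def density (f : SobolevSpace L r) : SobolevSpace L r := mulRight f (conj L r f)

theorem positionDensity_ae_eq (f : SobolevSpace L r) :
    positionDensity f.toL2 =ᵐ[AddCircle.haarAddCircle] f.density.toL2 := by
  filter_upwards [mulRight_ae_eq f (conj L r f), Lp.coeFn_star f.toL2] with x h1 h2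
  rw [density, h1, toL2_conj, h2, Pi.star_apply, Complex.star_def, Complex.mul_conj,
    Complex.normSq_eq_norm_sq]
  rfl

theorem continuous_density : Continuous (density (L := L) (r := r)) :=
  ((mulCLM L r).continuous).clm_apply (conj L r).continuous

theorem norm_density_le (f : SobolevSpace L r) : ‖f.density‖ ≤ mulConst L r * ‖f‖ * ‖f‖ :=
  (norm_mulRight_apply_le f _).trans (by
    have := mulConst_nonneg (L := L) (r := r)
    gcongr
    exact norm_conj_le f)

theorem norm_density_sub_le (f g : SobolevSpace L r) :
    ‖f.density - g.density‖ ≤ mulConst L r * (‖f‖ + ‖g‖) * ‖f - g‖ := by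
  have e : f.density - g.density =
      mulRight f (conj L r (f - g)) + mulRight (f - g) (conj L r g) := by
    rw [density, density, ← mulCLM_apply, ← mulCLM_apply, ← mulCLM_apply, map_sub, map_sub, map_sub,
      sub_apply]
    abel
  have h0 := mulConst_nonneg (L := L) (r := r)
  rw [e]
  calc _ ≤ mulConst L r * ‖f‖ * ‖f - g‖ + mulConst L r * ‖f - g‖ * ‖g‖ := by
        refine (norm_add_le _ _).trans (add_le_add ((norm_mulRight_apply_le _ _).trans ?_)
          ((norm_mulRight_apply_le _ _).trans ?_)) <;> gcongr <;> exact norm_conj_le _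
    _ = _ := by ring

end SobolevSpace

/-! ### The Schrödinger equation with a potential in `H^r` -/

namespace SobolevSpace

variable {L : ℝ} [hL : Fact (0 < L)] {q r : ℝ} [hq : Fact (1 ≤ q)] [hr : Fact (1 ≤ r)]

/-- Multiplication by `-i V` as a bounded operator on `H^r`. -/
noncomputable def gen (V : SobolevSpace L r) : SobolevSpace L r →L[ℝ] SobolevSpace L r :=
  mulRight ((-Complex.I) • V)

/-- Multiplication by `-i V` as a bounded operator on `L²`. -/
noncomputable def genL2 (V : SobolevSpace L r) : TorusL2 L →L[ℝ] TorusL2 L :=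
  mulOp ((-Complex.I) • V).contRep

theorem norm_gen_le (V : SobolevSpace L r) : ‖gen V‖ ≤ mulConst L r * ‖V‖ := by
  refine (norm_mulRight_le _).trans (le_of_eq ?_)
  rw [norm_smul, norm_neg, Complex.norm_I, one_mul]

theorem continuous_gen : Continuous (gen (L := L) (r := r)) :=
  (mulCLM L r).continuous.comp (continuous_const_smul (-Complex.I))

theorem toL2_gen (V f : SobolevSpace L r) : (gen V f).toL2 = genL2 V f.toL2 :=
  toL2_mulRight _ f

theorem embed_gen (h : q ≤ r) (V f : SobolevSpace L r) :
    embed L h (gen V f) = gen (embed L h V) (embed L h f) := by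
  apply toL2_injective
  have e : (-Complex.I) • embed L h V = embed L h ((-Complex.I) • V) := by
    apply toL2_injective
    rw [toL2_embed, map_smul, map_smul, toL2_embed]
  rw [toL2_embed, gen, gen, toL2_mulRight', toL2_mulRight', toL2_embed, e, toL2_embed]

theorem contRep_neg_I_smul_ae_eq (V : SobolevSpace L r) :
    ((-Complex.I) • V).contRep =ᵐ[AddCircle.haarAddCircle] fun x => -Complex.I * V.toL2 x := by
  filter_upwards [((-Complex.I) • V).contRep_ae_eq, Lp.coeFn_smul (-Complex.I) V.toL2] with x h1 h2
  rw [h1, map_smul, h2, Pi.smul_apply, smul_eq_mul]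

theorem genL2_apply (V : SobolevSpace L r) (f : TorusL2 L) :
    genL2 V f = (-Complex.I) • mulL2 V.toL2 f := by
  rw [genL2, mulOp_apply, mulL2_toL2, ← mulL2_smul_left]
  refine mulL2_congr ?_ f
  filter_upwards [contRep_neg_I_smul_ae_eq V, V.contRep_ae_eq] with x h1 h2
  rw [h1, ContinuousMap.smul_apply, h2, smul_eq_mul]

theorem isMildSolution_iff (V : SobolevSpace L r) (u₀ : TorusL2 L) (u : ℝ → TorusL2 L) :
    IsMildSolution V.toL2 u₀ u ↔ IsDuhamel (freeFlowL2 L) (genL2 V) u₀ u := by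
  refine and_congr_right fun _ => forall₂_congr fun t _ => ?_
  have e : ∀ ρ, freeFlowL2 L (t - ρ) (genL2 V (u ρ)) =
      (-Complex.I) • freeFlow (t - ρ) (mulL2 V.toL2 (u ρ)) := fun ρ => by
    rw [freeFlowL2_apply, genL2_apply, freeFlow_smul]
  simp only [e]
  rw [intervalIntegral.integral_smul, neg_smul, ← sub_eq_add_neg, freeFlowL2_apply]

theorem exp_smul_genL2_apply (V : SobolevSpace L r) (τ : ℝ) (f : TorusL2 L) :
    NormedSpace.exp (τ • genL2 V) f =
      mulL2 (fun x => Complex.exp (-(Complex.I * τ * V.toL2 x))) f := by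
  have e : τ • genL2 V = mulOp ((τ : ℂ) • ((-Complex.I) • V).contRep) := by
    ext1 g
    rw [smul_apply, mulOp_apply, mulL2_smul_left, torusL2_coe_smul, genL2, mulOp_apply]
  rw [e, exp_mulOp_apply]
  refine mulL2_congr ?_ f
  filter_upwards [contRep_neg_I_smul_ae_eq V] with x hx
  rw [ContinuousMap.smul_apply, hx, smul_eq_mul]
  congr 1
  ring

theorem lieTrotter_eq_lieSplit (V : SobolevSpace L r) (u₀ : TorusL2 L) (τ : ℝ) (n : ℕ) :
    lieTrotter V.toL2 u₀ τ n = lieSplit (freeFlowL2 L) (genL2 V) τ u₀ n := by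
  induction n with
  | zero => rfl
  | succ n ih => rw [lieTrotter, lieSplit, exp_smul_genL2_apply, freeFlowL2_apply, ih]

/-- The splitting with data and potential in `H^r` stays in `H^r`. -/
theorem lieTrotter_eq_toL2 (V f : SobolevSpace L r) (τ : ℝ) (n : ℕ) :
    lieTrotter V.toL2 f.toL2 τ n = (lieSplit (flow L r) (gen V) τ f n).toL2 := by
  rw [lieTrotter_eq_lieSplit]
  exact (map_lieSplit (toL2CLM L (zero_le_one.trans hr.out)) toL2_flow (toL2_gen V) τ f n).symm

theorem exists_unique_isMildSolution (V : SobolevSpace L r) (u₀ : TorusL2 L) :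
    ∃ u, IsMildSolution V.toL2 u₀ u ∧ ∀ w, IsMildSolution V.toL2 u₀ w → EqOn w u (Ici 0) := by
  obtain ⟨u, hu, -⟩ := exists_isDuhamel isIsometryGroup_freeFlowL2 (le_refl ‖genL2 V‖) u₀
  refine ⟨u, (isMildSolution_iff V u₀ u).2 hu, fun w hw => ?_⟩
  exact hu.unique isIsometryGroup_freeFlowL2 ((isMildSolution_iff V u₀ w).1 hw)

/-- The solution with data and potential in `H^r` stays in `H^r`: it agrees with the solution of
the Duhamel equation in `H^r`, by uniqueness in `L²`. -/
theorem exists_eq_toL2_of_isMildSolution (V f : SobolevSpace L r) {ψ : ℝ → TorusL2 L}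
    (hψ : IsMildSolution V.toL2 f.toL2 ψ) :
    ∃ u, IsDuhamel (flow L r) (gen V) f u ∧ ∀ t, 0 ≤ t → ψ t = (u t).toL2 := by
  obtain ⟨u, hu, -⟩ := exists_isDuhamel isIsometryGroup_flow (le_refl ‖gen V‖) f
  refine ⟨u, hu, fun t ht => ?_⟩
  have h := hu.map (S' := freeFlowL2 L) isIsometryGroup_flow
    (toL2CLM L (zero_le_one.trans hr.out)) toL2_flow (toL2_gen V)
  exact h.unique isIsometryGroup_freeFlowL2 ((isMildSolution_iff V f.toL2 ψ).1 hψ) ht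

end SobolevSpace

/-! ### Gaussian exponential moments -/

section Moments

instance : IsProbabilityMeasure gaussianProduct :=
  inferInstanceAs (IsProbabilityMeasure (Measure.infinitePi fun _ : ℕ => gaussianReal 0 1))

theorem integrable_exp_mul_abs_gaussianReal (A : ℝ) :
    Integrable (fun x => Real.exp (A * |x|)) (gaussianReal 0 1) :=
  integrable_exp_mul_abs (X := id) (integrable_exp_mul_gaussianReal A)
    (integrable_exp_mul_gaussianReal (-A))

theorem integrable_exp_mul_abs_coord (A : ℝ) (j : ℕ) :
    Integrable (fun ξ : ℕ → ℝ => Real.exp (A * |ξ j|)) gaussianProduct :=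
  (measurePreserving_eval_infinitePi (fun _ : ℕ => gaussianReal 0 1)
    j).integrable_comp_of_integrable (integrable_exp_mul_abs_gaussianReal A)

theorem integral_exp_mul_abs_coord (A : ℝ) (j : ℕ) :
    ∫ ξ : ℕ → ℝ, Real.exp (A * |ξ j|) ∂gaussianProduct =
      ∫ x, Real.exp (A * |x|) ∂gaussianReal 0 1 := by
  have h := measurePreserving_eval_infinitePi (fun _ : ℕ => gaussianReal 0 1) j
  rw [← h.map_eq, integral_map h.measurable.aemeasurable (by fun_prop)]
  rfl

/-- Exponential moments of `a₀ + ∑_{j < m} a_j |ξ_j|`, uniformly in `m`. By convexity of the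
exponential function only the marginals of the Gaussian measure enter. -/
theorem exists_exp_moment_bound {a : ℕ → ℝ} (ha : ∀ j, 0 ≤ a j) (hsum : Summable a) (a₀ : ℝ)
    {c : ℝ} (hc : 0 ≤ c) :
    ∃ M, 0 ≤ M ∧ ∀ m : ℕ,
      Integrable (fun ξ : ℕ → ℝ => Real.exp (c * (a₀ + ∑ j ∈ Finset.range m, a j * |ξ j|)))
        gaussianProduct ∧
      ∫ ξ : ℕ → ℝ, Real.exp (c * (a₀ + ∑ j ∈ Finset.range m, a j * |ξ j|)) ∂gaussianProduct ≤
        M := by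
  have hS : 0 ≤ c * ∑' j, a j := mul_nonneg hc (tsum_nonneg ha)
  set A := c * (∑' j, a j) + 1 with hA
  have hA0 : 0 < A := by linarith
  set E := ∫ x, Real.exp (A * |x|) ∂gaussianReal 0 1 with hE
  have hE0 : 0 ≤ E := integral_nonneg fun _ => (Real.exp_pos _).le
  refine ⟨Real.exp (c * a₀) * (1 + E), by positivity, fun m => ?_⟩
  -- the weights of the convex combination; the remaining mass sits at the point `0`
  set p : ℕ → ℝ := fun j => c * a j / A with hp
  have hp0 : ∀ j, 0 ≤ p j := fun j => by have := ha j; positivity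
  have hpsum : ∑ j ∈ Finset.range m, p j ≤ 1 := by
    simp only [hp]
    rw [← Finset.sum_div, ← Finset.mul_sum, div_le_one hA0]
    have := hsum.sum_le_tsum (Finset.range m) fun j _ => ha j
    nlinarith
  set v := 1 - ∑ j ∈ Finset.range m, p j with hv
  have hv0 : 0 ≤ v := by linarith
  have hbound : ∀ ξ : ℕ → ℝ, Real.exp (c * (a₀ + ∑ j ∈ Finset.range m, a j * |ξ j|)) ≤
      Real.exp (c * a₀) * (v + ∑ j ∈ Finset.range m, p j * Real.exp (A * |ξ j|)) := by
    intro ξ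
    have h := convexOn_exp.map_add_sum_le (t := Finset.range m) (w := p)
      (p := fun j => A * |ξ j|) (v := v) (q := 0) (fun j _ => hp0 j) (by rw [hv]; ring)
      (fun _ _ => mem_univ _) hv0 (mem_univ _)
    have e : c * (a₀ + ∑ j ∈ Finset.range m, a j * |ξ j|) =
        c * a₀ + (v • (0 : ℝ) + ∑ j ∈ Finset.range m, p j • (A * |ξ j|)) := by
      rw [mul_add, smul_zero, zero_add, Finset.mul_sum]
      congr 1
      refine Finset.sum_congr rfl fun j _ => ?_
      simp only [hp, smul_eq_mul]
      field_simp
    rw [e, Real.exp_add]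
    gcongr
    simpa using h
  have hint : Integrable (fun ξ : ℕ → ℝ => Real.exp (c * a₀) *
      (v + ∑ j ∈ Finset.range m, p j * Real.exp (A * |ξ j|))) gaussianProduct :=
    ((integrable_const v).add (integrable_finsetSum _ fun j _ =>
      (integrable_exp_mul_abs_coord A j).const_mul (p j))).const_mul _
  have hint' : Integrable (fun ξ : ℕ → ℝ =>
      Real.exp (c * (a₀ + ∑ j ∈ Finset.range m, a j * |ξ j|))) gaussianProduct := by
    refine hint.mono' (Continuous.aestronglyMeasurable (by fun_prop))
      (Filter.Eventually.of_forall fun ξ => ?_)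
    rw [Real.norm_of_nonneg (Real.exp_pos _).le]
    exact hbound ξ
  refine ⟨hint', (integral_mono hint' hint hbound).trans ?_⟩
  rw [integral_const_mul, integral_add (integrable_const v) (integrable_finsetSum _ fun j _ =>
      (integrable_exp_mul_abs_coord A j).const_mul (p j)),
    integral_finsetSum _ fun j _ => (integrable_exp_mul_abs_coord A j).const_mul (p j)]
  simp only [integral_const_mul, integral_exp_mul_abs_coord, ← hE, ← Finset.sum_mul]
  gcongr
  · simp only [integral_const, probReal_univ, one_smul]
    linarith [Finset.sum_nonneg fun j (_ : j ∈ Finset.range m) => hp0 j]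
  · exact mul_le_of_le_one_left hE0 hpsum

/-- The `L²` norm of a function that is dominated by a real function. -/
theorem memLp_two_of_norm_le {Ω E : Type*} [MeasurableSpace Ω] {μ : Measure Ω}
    [NormedAddCommGroup E] {f : Ω → E} (hf : AEStronglyMeasurable f μ) {g : Ω → ℝ}
    (hg : Integrable (fun ω => g ω ^ 2) μ) (hfg : ∀ ω, ‖f ω‖ ≤ g ω) {D : ℝ} (hD : 0 ≤ D)
    (hgD : ∫ ω, g ω ^ 2 ∂μ ≤ D ^ 2) :
    MemLp f 2 μ ∧ eLpNorm f 2 μ ≤ ENNReal.ofReal D := by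
  have h : eLpNorm f 2 μ ≤ ENNReal.ofReal D := by
    rw [eLpNorm_eq_lintegral_rpow_enorm_toReal two_ne_zero ENNReal.ofNat_ne_top]
    have h1 : ∫⁻ ω, ‖f ω‖ₑ ^ (2 : ENNReal).toReal ∂μ ≤ ENNReal.ofReal D ^ (2 : ℝ) := by
      calc _ ≤ ∫⁻ ω, ENNReal.ofReal (g ω ^ 2) ∂μ := by
            refine lintegral_mono fun ω => ?_
            have h0 : 0 ≤ g ω := (norm_nonneg _).trans (hfg ω)
            rw [← ofReal_norm, ENNReal.toReal_ofNat, ENNReal.rpow_ofNat,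
              ← ENNReal.ofReal_pow (norm_nonneg _)]
            exact ENNReal.ofReal_le_ofReal (by gcongr; exact hfg ω)
        _ = ENNReal.ofReal (∫ ω, g ω ^ 2 ∂μ) :=
            (ofReal_integral_eq_lintegral_ofReal hg
              (Filter.Eventually.of_forall fun ω => sq_nonneg _)).symm
        _ ≤ ENNReal.ofReal (D ^ 2) := ENNReal.ofReal_le_ofReal hgD
        _ = _ := by rw [ENNReal.ofReal_pow hD, ENNReal.rpow_ofNat]
    calc _ ≤ (ENNReal.ofReal D ^ (2 : ℝ)) ^ (1 / (2 : ENNReal).toReal) := by gcongr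
      _ = ENNReal.ofReal D := by
        rw [← ENNReal.rpow_mul, ENNReal.toReal_ofNat]
        norm_num
  exact ⟨⟨hf, h.trans_lt ENNReal.ofReal_lt_top⟩, h⟩

end Moments

/-! ### The error of the splitting for a random potential -/

section RandomPotential

open SobolevSpace

instance : Fact ((1 : ℝ) ≤ 1) := ⟨le_rfl⟩

variable {L : ℝ} [hL : Fact (0 < L)] {s : ℝ}

theorem continuous_truncPotential (v₀ : SobolevSpace L s) (v : ℕ → SobolevSpace L s)
    (lam : ℕ → ℝ) (m : ℕ) : Continuous (truncPotential v₀ v lam m) := by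
  unfold truncPotential
  fun_prop

/-- The random bound `‖v₀‖ + ∑_{j < m} λ_j ‖v_j‖ |ξ_j|` of the norm of the truncated potential. -/
noncomputable def potentialBound (v₀ : SobolevSpace L s) (v : ℕ → SobolevSpace L s) (lam : ℕ → ℝ)
    (m : ℕ) (ξ : ℕ → ℝ) : ℝ :=
  ‖v₀‖ + ∑ j ∈ Finset.range m, lam j * ‖v j‖ * |ξ j|

theorem norm_truncPotential_le (v₀ : SobolevSpace L s) (v : ℕ → SobolevSpace L s) {lam : ℕ → ℝ}
    (hlam : ∀ j, 0 < lam j) (m : ℕ) (ξ : ℕ → ℝ) :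
    ‖truncPotential v₀ v lam m ξ‖ ≤ potentialBound v₀ v lam m ξ := by
  refine (norm_add_le _ _).trans (add_le_add_right ((norm_sum_le _ _).trans
    (Finset.sum_le_sum fun j _ => le_of_eq ?_)) _)
  rw [norm_smul, Complex.norm_real, Real.norm_eq_abs, abs_mul, abs_of_pos (hlam j)]
  ring

theorem toSobolev_toL2_sub (f g : SobolevSpace L s) :
    MemSobolev (s - 2) (f.toL2 - g.toL2 : TorusL2 L) ∧
      toSobolev (s - 2) (f.toL2 - g.toL2 : TorusL2 L) =
        embed L (sub_le_self s zero_le_two) f - embed L (sub_le_self s zero_le_two) g := by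
  refine toSobolev_eq_of_ae_eq _ (Filter.EventuallyEq.of_eq ?_)
  rw [toL2_sub, toL2_embed, toL2_embed]

variable [hq : Fact (1 ≤ s - 2)]

/-- The position density of `f ∈ H^s` belongs to `H¹`. -/
theorem positionDensity_toL2 (f : SobolevSpace L s) :
    MemSobolev 1 (positionDensity f.toL2) ∧ toSobolev 1 (positionDensity f.toL2) =
      density (embed L hq.out (embed L (sub_le_self s zero_le_two) f)) := by
  refine toSobolev_eq_of_ae_eq _ ?_
  have h := positionDensity_ae_eq (embed L hq.out (embed L (sub_le_self s zero_le_two) f))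
  rwa [toL2_embed, toL2_embed] at h

variable [hs : Fact (1 ≤ s)]

/-- Pathwise bounds: the exact solution and the splitting in `H^s`, and the error in `H^{s - 2}`. -/
theorem pathwise_bounds (V f : SobolevSpace L s) {R : ℝ} (hR : ‖V‖ ≤ R) {u : ℝ → SobolevSpace L s}
    (hu : IsDuhamel (flow L s) (gen V) f u) {T τ : ℝ} (hτ : 0 ≤ τ) {n : ℕ} (hn : n * τ ≤ T) :
    ‖u (n * τ)‖ ≤ Real.exp ((mulConst L s + mulConst L (s - 2)) * R * T) * ‖f‖ ∧
    ‖lieSplit (flow L s) (gen V) τ f n‖ ≤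
      Real.exp ((mulConst L s + mulConst L (s - 2)) * R * T) * ‖f‖ ∧
    ‖embed L (sub_le_self s zero_le_two) (u (n * τ)) -
      embed L (sub_le_self s zero_le_two) (lieSplit (flow L s) (gen V) τ f n)‖ ≤
      4 * T * ‖f‖ * Real.exp ((mulConst L s + mulConst L (s - 2)) * R * (2 + T)) * τ := by
  have h1 := mulConst_nonneg (L := L) (r := s)
  have h2 := mulConst_nonneg (L := L) (r := s - 2)
  have hR0 : 0 ≤ R := (norm_nonneg _).trans hR
  set b := (mulConst L s + mulConst L (s - 2)) * R with hb_def
  have hb0 : 0 ≤ b := by positivity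
  have hb : ‖gen V‖ ≤ b := by
    refine (norm_gen_le V).trans ?_
    exact mul_le_mul (le_add_of_nonneg_right h2) hR (norm_nonneg _) (by positivity)
  have hb' : ‖gen (embed L (sub_le_self s zero_le_two) V)‖ ≤ b := by
    refine (norm_gen_le _).trans ?_
    exact mul_le_mul (le_add_of_nonneg_left h1) ((norm_embed_le _ V).trans hR) (norm_nonneg _)
      (by positivity)
  have hn0 : 0 ≤ n * τ := by positivity
  have hT : 0 ≤ T := hn0.trans hn
  have hexp : Real.exp (b * (n * τ)) ≤ Real.exp (b * T) := by gcongr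
  refine ⟨(hu.norm_le isIsometryGroup_flow hb hn0).trans (by gcongr),
    (norm_lieSplit_le isIsometryGroup_flow hb hτ f n).trans (by gcongr), ?_⟩
  have h := norm_lieSplit_error_le isIsometryGroup_flow
    (isIsometryGroup_flow (L := L) (r := s - 2)) (norm_embed_le (sub_le_self s zero_le_two))
    (embed_flow _) (embed_gen _ V) (fun t x ht => norm_flow_sub_le (by linarith) ht x) hb hb' hu
    hτ n
  rw [← map_lieSplit _ (embed_flow _) (embed_gen _ V)] at h
  refine h.trans ?_
  calc n * (τ ^ 2 * (4 * Real.exp (2 * b)) * (Real.exp (b * (n * τ)) * ‖f‖))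
      = (n * τ) * (4 * Real.exp (2 * b) * (Real.exp (b * (n * τ)) * ‖f‖)) * τ := by ring
    _ ≤ T * (4 * Real.exp (2 * b) * (Real.exp (b * T) * ‖f‖)) * τ := by gcongr
    _ = 4 * T * ‖f‖ * (Real.exp (2 * b) * Real.exp (b * T)) * τ := by ring
    _ = _ := by
      rw [← Real.exp_add]
      ring_nf

/-- Measurability of the exact solution at a fixed time in the random parameter: it is the
pointwise limit of splitting solutions, which depend continuously on the potential. -/
theorem stronglyMeasurable_embed_solution {α : Type*} [TopologicalSpace α] [MeasurableSpace α]
    [OpensMeasurableSpace α] [SecondCountableTopology α] {V : α → SobolevSpace L s}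
    (hV : Continuous V) (f : SobolevSpace L s) {u : α → ℝ → SobolevSpace L s}
    (hu : ∀ ξ, IsDuhamel (flow L s) (gen (V ξ)) f (u ξ)) {t : ℝ} (ht : 0 ≤ t) :
    StronglyMeasurable fun ξ => embed L (sub_le_self s zero_le_two) (u ξ t) := by
  refine stronglyMeasurable_of_tendsto Filter.atTop
    (f := fun (N : ℕ) ξ => lieSplit (flow L (s - 2))
      (gen (embed L (sub_le_self s zero_le_two) (V ξ))) (t / (N + 1 : ℕ))
      (embed L (sub_le_self s zero_le_two) f) (N + 1))
    (fun N => Continuous.stronglyMeasurable ?_) (tendsto_pi_nhds.2 fun ξ => ?_)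
  · exact continuous_lieSplit _ (continuous_gen.comp ((embed L _).continuous.comp hV)) _ _ _
  · exact tendsto_lieSplit isIsometryGroup_flow (isIsometryGroup_flow (L := L) (r := s - 2))
      (norm_embed_le (sub_le_self s zero_le_two)) (embed_flow _) (embed_gen _ (V ξ))
      (fun t x ht => norm_flow_sub_le (by linarith) ht x) (le_max_left _ _) (le_max_right _ _)
      (hu ξ) ht

/-- The mean square error of the wave function: the pathwise constant grows exponentially in the
norm of the potential, which has exponential moments uniformly in the truncation. -/
theorem exists_wave_error_bound (f v₀ : SobolevSpace L s) (v : ℕ → SobolevSpace L s)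
    {lam : ℕ → ℝ} (hlam : ∀ j, 0 < lam j) (hsum : Summable fun j => lam j * ‖v j‖) {T : ℝ}
    (hT : 0 ≤ T) :
    ∃ C, 0 ≤ C ∧ ∀ (m : ℕ) (u : (ℕ → ℝ) → ℝ → SobolevSpace L s),
      (∀ ξ, IsDuhamel (flow L s) (gen (truncPotential v₀ v lam m ξ)) f (u ξ)) →
      ∀ τ : ℝ, 0 < τ → ∀ n : ℕ, n * τ ≤ T →
        MemLp (fun ξ => embed L (sub_le_self s zero_le_two) (u ξ (n * τ)) -
          embed L (sub_le_self s zero_le_two)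
            (lieSplit (flow L s) (gen (truncPotential v₀ v lam m ξ)) τ f n)) 2 gaussianProduct ∧
        eLpNorm (fun ξ => embed L (sub_le_self s zero_le_two) (u ξ (n * τ)) -
          embed L (sub_le_self s zero_le_two)
            (lieSplit (flow L s) (gen (truncPotential v₀ v lam m ξ)) τ f n)) 2 gaussianProduct ≤
          ENNReal.ofReal (C * τ) := by
  have h1 := mulConst_nonneg (L := L) (r := s)
  have h2 := mulConst_nonneg (L := L) (r := s - 2)
  set K := mulConst L s + mulConst L (s - 2) with hK
  obtain ⟨M, hM0, hM⟩ := exists_exp_moment_bound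
    (fun j => mul_nonneg (hlam j).le (norm_nonneg (v j))) hsum ‖v₀‖
    (c := 2 * (K * (2 + T))) (by positivity)
  refine ⟨4 * T * ‖f‖ * √M, by positivity, fun m u hu τ hτ n hn => ?_⟩
  have hsq : ∀ ξ, (4 * T * ‖f‖ * Real.exp (K * potentialBound v₀ v lam m ξ * (2 + T)) * τ) ^ 2 =
      (4 * T * ‖f‖ * τ) ^ 2 * Real.exp (2 * (K * (2 + T)) *
        (‖v₀‖ + ∑ j ∈ Finset.range m, lam j * ‖v j‖ * |ξ j|)) := fun ξ => by
    rw [potentialBound, mul_right_comm _ (Real.exp _) τ, mul_pow, ← Real.exp_nat_mul]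
    congr 2
    push_cast
    ring
  refine memLp_two_of_norm_le ?_ (g := fun ξ => 4 * T * ‖f‖ *
    Real.exp (K * potentialBound v₀ v lam m ξ * (2 + T)) * τ) ?_ (fun ξ => ?_) (by positivity) ?_
  · refine ((stronglyMeasurable_embed_solution (continuous_truncPotential v₀ v lam m) f hu
      (by positivity)).sub (Continuous.stronglyMeasurable ?_)).aestronglyMeasurable
    exact (embed L _).continuous.comp (continuous_lieSplit _
      (continuous_gen.comp (continuous_truncPotential v₀ v lam m)) _ _ _)
  · simp only [hsq]
    exact (hM m).1.const_mul _
  · exact (pathwise_bounds _ f (norm_truncPotential_le v₀ v hlam m ξ) (hu ξ) hτ.le hn).2.2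
  · simp only [hsq]
    rw [integral_const_mul]
    calc _ ≤ (4 * T * ‖f‖ * τ) ^ 2 * M := by gcongr; exact (hM m).2
      _ = _ := by
        rw [show (4 * T * ‖f‖ * √M * τ) ^ 2 = (4 * T * ‖f‖ * τ) ^ 2 * √M ^ 2 by ring,
          Real.sq_sqrt hM0]

/-- The error of the expected observable. -/
theorem exists_observable_error_bound (f v₀ : SobolevSpace L s) (v : ℕ → SobolevSpace L s)
    {lam : ℕ → ℝ} (hlam : ∀ j, 0 < lam j) (hsum : Summable fun j => lam j * ‖v j‖)
    (G : StrongDual ℂ (SobolevSpace L 1)) {T : ℝ} (hT : 0 ≤ T) :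
    ∃ C, 0 ≤ C ∧ ∀ (m : ℕ) (u : (ℕ → ℝ) → ℝ → SobolevSpace L s),
      (∀ ξ, IsDuhamel (flow L s) (gen (truncPotential v₀ v lam m ξ)) f (u ξ)) →
      ∀ τ : ℝ, 0 < τ → ∀ n : ℕ, n * τ ≤ T →
        Integrable (fun ξ => G (toSobolev 1 (positionDensity (u ξ (n * τ)).toL2)))
          gaussianProduct ∧
        Integrable (fun ξ => G (toSobolev 1 (positionDensity
          (lieSplit (flow L s) (gen (truncPotential v₀ v lam m ξ)) τ f n).toL2)))
          gaussianProduct ∧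
        ‖(∫ ξ, G (toSobolev 1 (positionDensity (u ξ (n * τ)).toL2)) ∂gaussianProduct) -
          ∫ ξ, G (toSobolev 1 (positionDensity
            (lieSplit (flow L s) (gen (truncPotential v₀ v lam m ξ)) τ f n).toL2))
            ∂gaussianProduct‖ ≤ C * τ := by
  have h1 := mulConst_nonneg (L := L) (r := s)
  have h2 := mulConst_nonneg (L := L) (r := s - 2)
  have h3 := mulConst_nonneg (L := L) (r := 1)
  set K := mulConst L s + mulConst L (s - 2) with hK
  have ha : ∀ j, 0 ≤ lam j * ‖v j‖ := fun j => mul_nonneg (hlam j).le (norm_nonneg (v j))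
  obtain ⟨M, hM0, hM⟩ := exists_exp_moment_bound ha hsum ‖v₀‖ (c := K * (2 + 2 * T))
    (by positivity)
  obtain ⟨_, _, hM'⟩ := exists_exp_moment_bound ha hsum ‖v₀‖ (c := K * (2 * T)) (by positivity)
  refine ⟨‖G‖ * (mulConst L 1 * (8 * T * ‖f‖ ^ 2)) * M, by positivity,
    fun m u hu τ hτ n hn => ?_⟩
  set R := potentialBound v₀ v lam m with hR
  have hpath := fun ξ => pathwise_bounds _ f (norm_truncPotential_le v₀ v hlam m ξ) (hu ξ) hτ.le hn
  rw [← hK] at hpath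
  have hJ : ∀ g : SobolevSpace L s,
      ‖embed L hq.out (embed L (sub_le_self s zero_le_two) g)‖ ≤ ‖g‖ := fun g =>
    (norm_embed_le _ _).trans (norm_embed_le _ g)
  simp only [(positionDensity_toL2 _).2]
  -- a state of the size of the pathwise bounds has an integrable observable
  have hint : ∀ w : (ℕ → ℝ) → SobolevSpace L s,
      StronglyMeasurable (fun ξ => embed L (sub_le_self s zero_le_two) (w ξ)) →
      (∀ ξ, ‖w ξ‖ ≤ Real.exp (K * R ξ * T) * ‖f‖) →
      Integrable (fun ξ => G (density (embed L hq.out (embed L (sub_le_self s zero_le_two) (w ξ)))))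
        gaussianProduct := by
    intro w hw hwb
    refine ((hM' m).1.const_mul (‖G‖ * mulConst L 1 * ‖f‖ ^ 2)).mono' ?_
      (Filter.Eventually.of_forall fun ξ => ?_)
    · exact ((G.continuous.comp (continuous_density.comp
        (embed L hq.out).continuous)).comp_stronglyMeasurable hw).aestronglyMeasurable
    · have hb := (hJ (w ξ)).trans (hwb ξ)
      calc _ ≤ ‖G‖ * (mulConst L 1 * (Real.exp (K * R ξ * T) * ‖f‖) *
            (Real.exp (K * R ξ * T) * ‖f‖)) := by
            refine (G.le_opNorm _).trans ?_
            gcongr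
            exact (norm_density_le _).trans (by gcongr)
        _ = ‖G‖ * mulConst L 1 * ‖f‖ ^ 2 * (Real.exp (K * R ξ * T) * Real.exp (K * R ξ * T)) := by
            ring
        _ = _ := by
            rw [← Real.exp_add, hR, potentialBound]
            ring_nf
  have hi1 := hint (fun ξ => u ξ (n * τ)) (stronglyMeasurable_embed_solution
    (continuous_truncPotential v₀ v lam m) f hu (by positivity)) fun ξ => (hpath ξ).1
  have hi2 := hint (fun ξ => lieSplit (flow L s) (gen (truncPotential v₀ v lam m ξ)) τ f n)
    (Continuous.stronglyMeasurable ((embed L _).continuous.comp (continuous_lieSplit _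
      (continuous_gen.comp (continuous_truncPotential v₀ v lam m)) _ _ _)))
    fun ξ => (hpath ξ).2.1
  refine ⟨hi1, hi2, ?_⟩
  rw [← integral_sub hi1 hi2]
  refine (norm_integral_le_of_norm_le ((hM m).1.const_mul
    (‖G‖ * (mulConst L 1 * (8 * T * ‖f‖ ^ 2)) * τ))
    (Filter.Eventually.of_forall fun ξ => ?_)).trans ?_
  · obtain ⟨p1, p2, p3⟩ := hpath ξ
    have q1 := (hJ _).trans p1
    have q2 := (hJ _).trans p2
    rw [← map_sub] at p3
    have q3 := (norm_embed_le hq.out _).trans p3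
    rw [map_sub, map_sub] at q3
    rw [← map_sub]
    calc _ ≤ ‖G‖ * (mulConst L 1 *
          (Real.exp (K * R ξ * T) * ‖f‖ + Real.exp (K * R ξ * T) * ‖f‖) *
          (4 * T * ‖f‖ * Real.exp (K * R ξ * (2 + T)) * τ)) := by
          refine (G.le_opNorm _).trans ?_
          gcongr
          exact (norm_density_sub_le _ _).trans (by gcongr)
      _ = ‖G‖ * (mulConst L 1 * (8 * T * ‖f‖ ^ 2)) * τ *
          (Real.exp (K * R ξ * T) * Real.exp (K * R ξ * (2 + T))) := by ring
      _ = _ := by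
          rw [← Real.exp_add, hR, potentialBound]
          ring_nf
  · rw [integral_const_mul]
    calc _ ≤ ‖G‖ * (mulConst L 1 * (8 * T * ‖f‖ ^ 2)) * τ * M := by gcongr; exact (hM m).2
      _ = _ := by ring

end RandomPotential

theorem mainTheorem4 {L : ℝ} [Fact (0 < L)] (s : ℝ) (hs : 3 ≤ s)
    (ψin v₀ : SobolevSpace L s) (v : ℕ → SobolevSpace L s) (lam : ℕ → ℝ)
    (hv₀ : ∀ᵐ x ∂(AddCircle.haarAddCircle : Measure (AddCircle L)), (v₀.toL2 x).im = 0)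
    (hv : ∀ j, ∀ᵐ x ∂(AddCircle.haarAddCircle : Measure (AddCircle L)), ((v j).toL2 x).im = 0)
    (hlam_pos : ∀ j, 0 < lam j) (hlam_anti : Antitone lam)
    (hsum : Summable fun j => lam j * ‖v j‖)
    (G : StrongDual ℂ (SobolevSpace L 1)) :
    (∀ (m : ℕ) (ξ : ℕ → ℝ), ∃ u : ℝ → TorusL2 L,
      IsMildSolution (truncPotential v₀ v lam m ξ).toL2 ψin.toL2 u ∧
        ∀ w : ℝ → TorusL2 L,
          IsMildSolution (truncPotential v₀ v lam m ξ).toL2 ψin.toL2 w → EqOn w u (Ici 0)) ∧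
    ∀ T : ℝ, 0 < T → ∃ C : ℝ, 0 < C ∧
      ∀ (m : ℕ) (ψ : (ℕ → ℝ) → ℝ → TorusL2 L),
        (∀ ξ, IsMildSolution (truncPotential v₀ v lam m ξ).toL2 ψin.toL2 (ψ ξ)) →
        ∀ τ : ℝ, 0 < τ → τ ≤ T → ∀ n : ℕ, n * τ ≤ T →
          -- error of the wave function in `L²_μ(U, H^{s-2}(𝕋))`
          ((∀ ξ, MemSobolev (s - 2)
              (ψ ξ (n * τ) -
                lieTrotter (truncPotential v₀ v lam m ξ).toL2 ψin.toL2 τ n : TorusL2 L)) ∧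
            MemLp (fun ξ => toSobolev (s - 2)
              (ψ ξ (n * τ) -
                lieTrotter (truncPotential v₀ v lam m ξ).toL2 ψin.toL2 τ n : TorusL2 L))
              2 gaussianProduct ∧
            eLpNorm (fun ξ => toSobolev (s - 2)
              (ψ ξ (n * τ) -
                lieTrotter (truncPotential v₀ v lam m ξ).toL2 ψin.toL2 τ n : TorusL2 L))
              2 gaussianProduct ≤ ENNReal.ofReal (C * τ)) ∧
          -- error of the expected observable
          ((∀ ξ, MemSobolev 1 (positionDensity (ψ ξ (n * τ)))) ∧
            (∀ ξ, MemSobolev 1 (positionDensity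
              (lieTrotter (truncPotential v₀ v lam m ξ).toL2 ψin.toL2 τ n))) ∧
            Integrable (fun ξ => G (toSobolev 1 (positionDensity (ψ ξ (n * τ)))))
              gaussianProduct ∧
            Integrable (fun ξ => G (toSobolev 1 (positionDensity
              (lieTrotter (truncPotential v₀ v lam m ξ).toL2 ψin.toL2 τ n))))
              gaussianProduct ∧
            ‖(∫ ξ, G (toSobolev 1 (positionDensity (ψ ξ (n * τ)))) ∂gaussianProduct) -
              ∫ ξ, G (toSobolev 1 (positionDensity
                (lieTrotter (truncPotential v₀ v lam m ξ).toL2 ψin.toL2 τ n)))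
                ∂gaussianProduct‖ ≤ C * τ) := by
  have : Fact (1 ≤ s) := ⟨by linarith⟩
  have : Fact (1 ≤ s - 2) := ⟨by linarith⟩
  refine ⟨fun m ξ => SobolevSpace.exists_unique_isMildSolution _ _, fun T hT => ?_⟩
  obtain ⟨C₁, hC₁, h₁⟩ := exists_wave_error_bound ψin v₀ v hlam_pos hsum hT.le
  obtain ⟨C₂, hC₂, h₂⟩ := exists_observable_error_bound ψin v₀ v hlam_pos hsum G hT.le
  -- the summand `1` makes the constant positive
  refine ⟨C₁ + C₂ + 1, by positivity, fun m ψ hψ τ hτ _ n hn => ?_⟩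
  choose u hu hψu using fun ξ => SobolevSpace.exists_eq_toL2_of_isMildSolution _ ψin (hψ ξ)
  have hn0 : 0 ≤ n * τ := by positivity
  obtain ⟨hmem, herr⟩ := h₁ m u hu τ hτ n hn
  obtain ⟨hint, hint', hobs⟩ := h₂ m u hu τ hτ n hn
  simp only [hψu _ _ hn0, SobolevSpace.lieTrotter_eq_toL2]
  have hto := fun ξ => toSobolev_toL2_sub (u ξ (n * τ))
    (lieSplit (SobolevSpace.flow L s) (SobolevSpace.gen (truncPotential v₀ v lam m ξ)) τ ψin n)
  simp only [fun ξ => (hto ξ).2]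
  refine ⟨⟨fun ξ => (hto ξ).1, hmem, herr.trans (ENNReal.ofReal_le_ofReal ?_)⟩,
    fun ξ => (positionDensity_toL2 _).1, fun ξ => (positionDensity_toL2 _).1, hint, hint',
    hobs.trans ?_⟩
  · gcongr
    linarith
  · gcongr
    linarith
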